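/- **Setting.** A network is a finite directed acyclic graph with three unicast sessions $i=1,2,3$. Sender $s_i$ has no incoming edge and a single outgoing edge $\sigma_i$; receiver $d_i$ has no outgoing edge and a single incoming edge $\tau_i$; the senders are distinct nodes, and so are the receivers. To every pair of consecutive edges $(e',e)$ a variable $x_{e'e}$ (coding coefficient) is attached; $\mathbf x$ is the vector of all of them. The transfer function $m_{ji}(\mathbf x)\in\mathbb F_2[\mathbf x]$ is the sum, over all directed paths from $\sigma_j$ to $\tau_i$, of the product of the coding coefficients along the path. Assume that every sender is connected to every receiver by a directed path. Put $$p_1=\frac{m_{13}m_{21}}{m_{11}m_{23}},\quad p_2=\frac{m_{13}m_{22}}{m_{12}m_{23}},\quad p_3=\frac{m_{21}m_{33}}{m_{23}m_{31}},\quad \eta=\frac{m_{13}m_{21}m_{32}}{m_{12}m_{23}m_{31}}.$$ The network is of *Type II* if $p_i\notin\{1,\eta\}$ for $i=1,2,3$ and at least one of the relations $p_1=\frac{\eta}{1+\eta}$, $p_2=1+\eta$, $p_3=1+\eta$ holds. A *precoding-based linear scheme* over $N$ time slots has variables $\xi=(\mathbf x^{(1)},\dots,\mathbf x^{(N)},\theta_1,\dots,\theta_q)$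 and, for each field $\mathbb F_{2^m}$, precoding matrices $\mathbf V_i\in\mathbb F_{2^m}(\xi)^{N\times k_i}$ with $k_i\le N$ ($i=1,2,3$). If sender $j$ has the source symbols $\mathbf X_j\in\mathbb F_{2^m}^{k_j}$, receiver $d_i$ gets $\sum_j \mathbf M_{ji}\mathbf V_j\mathbf X_j$, where $\mathbf M_{ji}=\mathrm{diag}(m_{ji}(\mathbf x^{(1)}),\dots,m_{ji}(\mathbf x^{(N)}))$. The scheme *achieves* the rate tuple $(k_1/N,k_2/N,k_3/N)$ if, for $\xi$ uniformly distributed over $\mathbb F_{2^m}$, the probability that all denominators in the $\mathbf V_i$ are non-zero and that every $d_i$ can decode $\mathbf X_i$ tends to $1$ as $m\to\infty$. A *PBNA* with $2n+s$ symbol extensions ($n\ge1$, $s\in\{0,1\}$) is such a scheme with $N=2n+s$, $k_1=n+s$, $k_2=k_3=n$, with $\mathbf V_1,\mathbf V_2,\mathbf V_3$ of full column rank over $\mathbb F_{2^m}(\xi)$, and with $\mathrm{span}(\mathbf M_{21}\mathbf V_2)=\mathrm{span}(\mathbf M_{31}\mathbf V_3)$, $\mathrm{span}(\mathbf M_{32}\mathbf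 V_3)\subseteq\mathrm{span}(\mathbf M_{12}\mathbf V_1)$, $\mathrm{span}(\mathbf M_{23}\mathbf V_2)\subseteq\mathrm{span}(\mathbf M_{13}\mathbf V_1)$ (column spans). The *Cadambe–Jafar precoders* with parameter $n$ are, for $N=2n+1$, $$\mathbf V_1=(\mathbf w\;\mathbf T\mathbf w\;\cdots\;\mathbf T^n\mathbf w),\quad \mathbf V_2=\mathbf M_{13}\mathbf M_{23}^{-1}(\mathbf w\;\cdots\;\mathbf T^{n-1}\mathbf w),\quad \mathbf V_3=\mathbf M_{12}\mathbf M_{32}^{-1}(\mathbf T\mathbf w\;\cdots\;\mathbf T^{n}\mathbf w),$$ with $\mathbf w$ the all-ones vector and $\mathbf T=\mathbf M_{13}\mathbf M_{21}\mathbf M_{32}\mathbf M_{12}^{-1}\mathbf M_{23}^{-1}\mathbf M_{31}^{-1}$. **Statement.** For every Type II network (with all senders connected to all receivers): 1. After a suitable renumbering of the three sessions, the scheme with the Cadambe–Jafar precoders for $n=2$ is a PBNA with $5$ symbol extensions and, when the sender that has three precoding columns uses only two suitable ones of them, it achieves the rate $2/5$ for every user. 2. Hence the outer bound $2/5$ is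 tight: $2/5$ is the largest $R$ such that some precoding-based linear scheme achieves the rate tuple $(R,R,R)$. -/

import Mathlib

open Filter Topology Matrix

/-- A directed acyclic network (parallel edges are allowed). An edge `e` goes from the node
`tail e` to the node `head e`. -/
structure Network (V E : Type*) where
  tail : E → V
  head : E → V
  acyclic : ∀ e : E, ¬ Relation.TransGen (fun e₁ e₂ => head e₁ = tail e₂) e e

/-- A single-input single-output communication scenario with three unicast sessions, numbered
by `Fin 3`: sender `s i`, receiver `d i`, sender edge `σ i`, receiver edge `τ i`. -/
structure SISOScenario (V E : Type*) extends Network V E where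
  s : Fin 3 → V
  d : Fin 3 → V
  σ : Fin 3 → E
  τ : Fin 3 → E
  s_injective : Function.Injective s
  d_injective : Function.Injective d
  /-- `σ i` is the only edge leaving `s i`. -/
  tail_eq_s_iff : ∀ (i : Fin 3) (e : E), tail e = s i ↔ e = σ i
  /-- `τ i` is the only edge entering `d i`. -/
  head_eq_d_iff : ∀ (i : Fin 3) (e : E), head e = d i ↔ e = τ i
  head_ne_s : ∀ (i : Fin 3) (e : E), head e ≠ s i
  tail_ne_d : ∀ (i : Fin 3) (e : E), tail e ≠ d i

/-- The same network with the three sessions renumbered: the new session `i` is the old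
session `π i`. -/
def SISOScenario.relabel {V E : Type*} (S : SISOScenario V E) (π : Equiv.Perm (Fin 3)) :
    SISOScenario V E where
  toNetwork := S.toNetwork
  s := S.s ∘ π
  d := S.d ∘ π
  σ := S.σ ∘ π
  τ := S.τ ∘ π
  s_injective := S.s_injective.comp π.injective
  d_injective := S.d_injective.comp π.injective
  tail_eq_s_iff := fun i => S.tail_eq_s_iff (π i)
  head_eq_d_iff := fun i => S.head_eq_d_iff (π i)
  head_ne_s := fun i => S.head_ne_s (π i)
  tail_ne_d := fun i => S.tail_ne_d (π i)

namespace Network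

variable {V E : Type*} (G : Network V E)

/-- The index type of the coding coefficients `x_{e'e}`: pairs of consecutive edges. -/
abbrev CodingVar : Type _ := {p : E × E // G.head p.1 = G.tail p.2}

/-- `P` is a directed path from the edge `e` to the edge `e'` (listed edge by edge). -/
def IsPath (e e' : E) (P : List E) : Prop :=
  P.IsChain (fun e₁ e₂ => G.head e₁ = G.tail e₂) ∧ P.head? = some e ∧ P.getLast? = some e'

open Classical in
/-- The product of the coding coefficients along a list of consecutive edges. -/
noncomputable def pathGain (R : Type*) [CommRing R] : List E → MvPolynomial G.CodingVar R
  | [] => 1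
  | [_] => 1
  | e :: e' :: P =>
      (if h : G.head e = G.tail e' then MvPolynomial.X ⟨(e, e'), h⟩ else 0)
        * pathGain R (e' :: P)

open Classical in
/-- The sum of the gains of all directed paths from `e` to `e'`. (The network being acyclic,
every directed path is a list without repetitions.) -/
noncomputable def pathSum [Fintype E] (R : Type*) [CommRing R] (e e' : E) :
    MvPolynomial G.CodingVar R :=
  ∑ P : {P : List E // P.Nodup}, if G.IsPath e e' P.1 then G.pathGain R P.1 else 0

/-- The variables `ξ`: the coding coefficients of each of the `N` time slots, and `q` further
variables `θ` for the senders. -/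
abbrev SchemeVar (N q : ℕ) : Type _ := (Fin N × G.CodingVar) ⊕ Fin q

/-- The field of rational functions in the variables `ξ` over the field with `2 ^ m` elements. -/
abbrev SchemeField (N q m : ℕ) : Type _ :=
  FractionRing (MvPolynomial (G.SchemeVar N q) (GaloisField 2 m))

end Network

namespace SISOScenario

variable {V E : Type*} [Fintype E] (S : SISOScenario V E)

/-- Every sender is connected to every receiver by a directed path. -/
def FullyConnected {V E : Type*} (S : SISOScenario V E) : Prop :=
  ∀ i j : Fin 3, ∃ P : List E, S.IsPath (S.σ i) (S.τ j) P

/-- The transfer function from `σ j` to `τ i`, as a polynomial with coefficients in `R`. -/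
noncomputable def transfer (R : Type*) [CommRing R] (j i : Fin 3) :
    MvPolynomial S.CodingVar R :=
  S.pathSum R (S.σ j) (S.τ i)

/-- The transfer function from `σ j` to `τ i` in the field of rational functions over `𝔽₂`. -/
noncomputable def tf (j i : Fin 3) : FractionRing (MvPolynomial S.CodingVar (ZMod 2)) :=
  algebraMap _ _ (S.transfer (ZMod 2) j i)

/-- The rational functions `p₁, p₂, p₃`. -/
noncomputable def p : Fin 3 → FractionRing (MvPolynomial S.CodingVar (ZMod 2))
  | 0 => (S.tf 0 2 * S.tf 1 0) / (S.tf 0 0 * S.tf 1 2)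
  | 1 => (S.tf 0 2 * S.tf 1 1) / (S.tf 0 1 * S.tf 1 2)
  | 2 => (S.tf 1 0 * S.tf 2 2) / (S.tf 1 2 * S.tf 2 0)

/-- The rational function `η`. -/
noncomputable def eta : FractionRing (MvPolynomial S.CodingVar (ZMod 2)) :=
  (S.tf 0 2 * S.tf 1 0 * S.tf 2 1) / (S.tf 0 1 * S.tf 1 2 * S.tf 2 0)

/-- Type II networks. -/
def TypeII : Prop :=
  (∀ i : Fin 3, S.p i ≠ 1 ∧ S.p i ≠ S.eta) ∧
    (S.p 0 = S.eta / (1 + S.eta) ∨ S.p 1 = 1 + S.eta ∨ S.p 2 = 1 + S.eta)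

/-- The diagonal `N × N` matrix `M_{ji}` of the transfer functions from `σ j` to `τ i` in the
`N` time slots, over the field of rational functions in `ξ`. -/
noncomputable def M (N q m : ℕ) (j i : Fin 3) :
    Matrix (Fin N) (Fin N) (S.SchemeField N q m) :=
  Matrix.diagonal fun t =>
    algebraMap (MvPolynomial (S.SchemeVar N q) (GaloisField 2 m)) _
      (MvPolynomial.rename (fun v => Sum.inl (t, v)) (S.transfer (GaloisField 2 m) j i))

end SISOScenario

/-- A precoding-based linear scheme over `N` time slots, in which session `i` sends `k i`
symbols with an `N × k i` precoding matrix of rational functions in `ξ`. The rate of a scheme is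
defined by a limit `m → ∞`, so there is a precoding matrix `V m i` for each field size `2 ^ m`. -/
structure PrecodingScheme {V E : Type*} (G : Network V E) where
  N : ℕ
  N_pos : 0 < N
  k : Fin 3 → ℕ
  k_le : ∀ i, k i ≤ N
  /-- the number of variables `θ` -/
  q : ℕ
  V : (m : ℕ) → (i : Fin 3) → Matrix (Fin N) (Fin (k i)) (G.SchemeField N q m)

namespace PrecodingScheme

/-- The value of a rational function (written in lowest terms) at a point `ξ₀`. -/
noncomputable def evalAt {ι K : Type*} [Field K] (ξ₀ : ι → K)
    (f : FractionRing (MvPolynomial ι K)) : K :=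
  MvPolynomial.eval ξ₀ (IsFractionRing.num (MvPolynomial ι K) f) /
    MvPolynomial.eval ξ₀ (IsFractionRing.den (MvPolynomial ι K) f : MvPolynomial ι K)

/-- The denominator of `f` (written in lowest terms) does not vanish at `ξ₀`. -/
def DefinedAt {ι K : Type*} [Field K] (ξ₀ : ι → K) (f : FractionRing (MvPolynomial ι K)) : Prop :=
  MvPolynomial.eval ξ₀ (IsFractionRing.den (MvPolynomial ι K) f : MvPolynomial ι K) ≠ 0

variable {V E : Type*}

/-- The scheme obtained when session `i` uses only the columns `c i` of its precoding matrix
(it sends zero on the other ones). -/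
def select {G : Network V E} (lam : PrecodingScheme G) (k' : Fin 3 → ℕ)
    (c : (i : Fin 3) → Fin (k' i) ↪ Fin (lam.k i)) : PrecodingScheme G where
  N := lam.N
  N_pos := lam.N_pos
  k := k'
  k_le := fun i => le_trans (by simpa using Fintype.card_le_of_embedding (c i)) (lam.k_le i)
  q := lam.q
  V := fun m i => (lam.V m i).submatrix id (c i)

variable [Fintype E] (S : SISOScenario V E)

/-- The vector of the `N` symbols received on `τ i`, when the variables `ξ` take the values `ξ₀`
and the source symbols are `X`. -/
noncomputable def received (lam : PrecodingScheme S.toNetwork) (m : ℕ)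
    (ξ₀ : S.SchemeVar lam.N lam.q → GaloisField 2 m)
    (X : (j : Fin 3) → Fin (lam.k j) → GaloisField 2 m) (i : Fin 3) :
    Fin lam.N → GaloisField 2 m :=
  fun t => ∑ j : Fin 3,
    MvPolynomial.eval (fun v => ξ₀ (Sum.inl (t, v))) (S.transfer (GaloisField 2 m) j i) *
      (((lam.V m j).map (evalAt ξ₀)) *ᵥ X j) t

/-- At `ξ₀` the denominators of the precoding matrices do not vanish, and every receiver can
decode the symbols of its own sender from what it receives. -/
def Success (lam : PrecodingScheme S.toNetwork) (m : ℕ)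
    (ξ₀ : S.SchemeVar lam.N lam.q → GaloisField 2 m) : Prop :=
  (∀ i t c, DefinedAt ξ₀ (lam.V m i t c)) ∧
    ∀ i, ∃ D : (Fin lam.N → GaloisField 2 m) → (Fin (lam.k i) → GaloisField 2 m),
      ∀ X, D (received S lam m ξ₀ X i) = X i

/-- The probability of success when the variables `ξ` are independent and uniform on the field
with `2 ^ m` elements. -/
noncomputable def successProb (lam : PrecodingScheme S.toNetwork) (m : ℕ) : ℝ :=
  (Nat.card {ξ₀ : S.SchemeVar lam.N lam.q → GaloisField 2 m // Success S lam m ξ₀} : ℝ) /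
    (Nat.card (S.SchemeVar lam.N lam.q → GaloisField 2 m) : ℝ)

/-- The scheme achieves the rate tuple `r`. -/
def Achieves (lam : PrecodingScheme S.toNetwork) (r : Fin 3 → ℚ) : Prop :=
  (∀ i, r i = (lam.k i : ℚ) / (lam.N : ℚ)) ∧
    Tendsto (fun m => successProb S lam m) atTop (𝓝 1)

/-- The space spanned by the columns of a matrix. -/
def colSpan {ι κ F : Type*} [Field F] (A : Matrix ι κ F) : Submodule F (ι → F) :=
  Submodule.span F (Set.range A.col)

/-- The scheme is a precoding-based network alignment scheme with `2 * n + s` symbol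
extensions. -/
def IsPBNA (lam : PrecodingScheme S.toNetwork) (n s : ℕ) : Prop :=
  0 < n ∧ (s = 0 ∨ s = 1) ∧ lam.N = 2 * n + s ∧
    lam.k 0 = n + s ∧ lam.k 1 = n ∧ lam.k 2 = n ∧
    ∀ m : ℕ, 0 < m →
      (lam.V m 0).rank = n + s ∧ (lam.V m 1).rank = n ∧ (lam.V m 2).rank = n ∧
      colSpan (S.M lam.N lam.q m 1 0 * lam.V m 1) =
        colSpan (S.M lam.N lam.q m 2 0 * lam.V m 2) ∧
      colSpan (S.M lam.N lam.q m 2 1 * lam.V m 2) ≤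
        colSpan (S.M lam.N lam.q m 0 1 * lam.V m 0) ∧
      colSpan (S.M lam.N lam.q m 1 2 * lam.V m 1) ≤
        colSpan (S.M lam.N lam.q m 0 2 * lam.V m 0)

/-- The diagonal matrix `T` whose entries are the values of `η` in the `2 * n + 1` time slots. -/
noncomputable def cjT (n m : ℕ) :
    Matrix (Fin (2 * n + 1)) (Fin (2 * n + 1)) (S.SchemeField (2 * n + 1) 0 m) :=
  S.M _ _ m 0 2 * S.M _ _ m 1 0 * S.M _ _ m 2 1 *
    (S.M _ _ m 0 1)⁻¹ * (S.M _ _ m 1 2)⁻¹ * (S.M _ _ m 2 0)⁻¹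

/-- Column number `c` (counted from `0`) of the Cadambe-Jafar precoding matrices
`V₁ = (w, T w, …, Tⁿ w)`, `V₂ = M₁₃ M₂₃⁻¹ (w, …, Tⁿ⁻¹ w)`, `V₃ = M₁₂ M₃₂⁻¹ (T w, …, Tⁿ w)`, where
`w` is the all-ones vector. -/
noncomputable def cjCol (n m : ℕ) :
    Fin 3 → ℕ → Fin (2 * n + 1) → S.SchemeField (2 * n + 1) 0 m
  | 0, c => (cjT S n m ^ c) *ᵥ 1
  | 1, c => (S.M _ _ m 0 2 * (S.M _ _ m 1 2)⁻¹ * cjT S n m ^ c) *ᵥ 1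
  | 2, c => (S.M _ _ m 0 1 * (S.M _ _ m 2 1)⁻¹ * cjT S n m ^ (c + 1)) *ᵥ 1

/-- The scheme with the Cadambe-Jafar precoding matrices over `2 * n + 1` time slots. -/
noncomputable def cadambeJafar (n : ℕ) : PrecodingScheme S.toNetwork where
  N := 2 * n + 1
  N_pos := by omega
  k := fun i => if i = 0 then n + 1 else n
  k_le := fun i => by split_ifs <;> omega
  q := 0
  V := fun m i => Matrix.of fun t c => cjCol S n m i c t

end PrecodingScheme

/-!
Here sessions are numbered `1, 2, 3`, in the lemmas `0, 1, 2`. Write `m_ji` for the transfer functions, `P = m₁₃ m₂₁ m₃₂` and `Q = m₁₂ m₂₃ m₃₁`, so that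
`η = P / Q`. The conditions `p_i ∉ {1, η}` say that `m_ii m_jk ≠ m_ik m_ji` for all distinct
`i, j, k`, and the three relations of which a Type II network satisfies one say that
`m₁₁ m₂₃ m₃₂`, `m₂₂ m₁₃ m₃₁` or `m₃₃ m₁₂ m₂₁` equals `P + Q`. They are permuted by cyclic
renumberings of the sessions, so one may assume `m₁₁ m₂₃ m₃₂ = P + Q`, the cross relation
(`TypeII.exists_relabel`).

*Outer bound.* At a point where no transfer function vanishes, the cross relation says
`m₁₁ = m₃₁ (m₁₂ / m₃₂) + m₂₁ (m₁₃ / m₂₃)`. A signal of session 1 that is aligned with session 3 at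
receiver 2 and with session 2 at receiver 3 is therefore indistinguishable from interference at
receiver 1, hence zero. Each of the two alignments holds on a space of dimension at least `3k - N`,
so `2 (3k - N) ≤ k` (`two_mul_sum_le_of_decodable`).

*Achievability.* Session 1 uses the columns `1` and `η²`. At receiver 1 the cross relation makes
the received signal a polynomial of degree at most three in `η`, whose extreme coefficients are the
wanted symbols. At receiver 2 the interference lies in the span of `1, η, η²`, so decoding needs
`p₂, p₂ η, 1, η, η²` to be independent, in the sense that five generic time slots give a nonsingular
matrix; likewise at receiver 3. This follows once some coding coefficient occurs in `m₂₂` but in no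
other transfer function, because it can then be used to give `p₂` arbitrary values while `η` stays
the same (`det_pairingMatrix_slotCopy_ne_zero`).

*The private coding coefficient.* As the network is acyclic, the matrix of transfer functions is
affine in each coding coefficient `x_{eg}`, with a linear part `a bᵀ` of rank one, where `a_j` is
nonzero if sender `j` reaches `e`, and `b_i` is nonzero if `g` reaches receiver `i`
(`scaleHom_pathSum`). Scaling all coefficients `x_{eg}` of an edge `e` gives such a perturbation as
well. Comparing coefficients in the cross relation leaves few possible patterns of zeros of `a` and
`b`. Walking along a path from sender 2 to receiver 2, these patterns force a step with
`a = b = (0, *, 0)` (`hasFreeVariable_one`).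

The events in question contain the non-vanishing of a polynomial over `𝔽₂` that does not depend on
`m`, so the Schwartz–Zippel lemma gives the limits as `m → ∞`.
-/

/-! ### Path sums as the inverse of a matrix -/

namespace Network

section PathSums

variable {V E : Type*} (G : Network V E)

/-- `G.Reaches e e'`: some directed path starts with the edge `e` and ends with the edge `e'`. -/
def Reaches : E → E → Prop :=
  Relation.ReflTransGen fun e₁ e₂ => G.head e₁ = G.tail e₂

variable {G}

theorem IsPath.reaches {e e' : E} {P : List E} (h : G.IsPath e e' P) : G.Reaches e e' := by
  obtain ⟨hc, hh, hl⟩ := h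
  cases P with
  | nil => simp at hh
  | cons a l =>
    obtain rfl : a = e := by simpa using hh
    refine List.relationReflTransGen_of_exists_isChain_cons l hc ?_
    rw [List.getLast?_eq_some_getLast (List.cons_ne_nil _ _)] at hl
    simpa using hl

theorem not_reaches_of_consecutive {e g : E} (h : G.head e = G.tail g) : ¬ G.Reaches g e :=
  fun hr => G.acyclic e (Relation.TransGen.head' h hr)

/-- Acyclicity makes every directed path a list without repetitions. -/
theorem nodup_of_isChain {P : List E} (h : P.IsChain fun e₁ e₂ => G.head e₁ = G.tail e₂) :
    P.Nodup := by
  have h' : P.Pairwise (Relation.TransGen fun e₁ e₂ => G.head e₁ = G.tail e₂) :=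
    List.isChain_iff_pairwise.1 (h.imp fun _ _ => Relation.TransGen.single)
  exact h'.imp fun {a b} hab => by rintro rfl; exact G.acyclic _ hab

theorem isPath_singleton {a e e' : E} : G.IsPath e e' [a] ↔ a = e ∧ a = e' := by
  simp [IsPath]

theorem isPath_cons_cons {a b e e' : E} {l : List E} :
    G.IsPath e e' (a :: b :: l) ↔ a = e ∧ G.head a = G.tail b ∧ G.IsPath b e' (b :: l) := by
  simp only [IsPath, List.isChain_cons_cons, List.head?_cons, Option.some.injEq,
    List.getLast?_cons_cons]
  tauto

variable (G)

open Classical in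
/-- The matrix of the coding coefficients: the entry at `(e, g)` is `x_{eg}` if `g` directly
follows `e`, and `0` otherwise. -/
noncomputable def stepMatrix (R : Type*) [CommRing R] : Matrix E E (MvPolynomial G.CodingVar R) :=
  Matrix.of fun e g => if h : G.head e = G.tail g then MvPolynomial.X ⟨(e, g), h⟩ else 0

theorem pathGain_cons_cons (R : Type*) [CommRing R] (e g : E) (P : List E) :
    G.pathGain R (e :: g :: P) = G.stepMatrix R e g * G.pathGain R (g :: P) := rfl

theorem stepMatrix_of_ne (R : Type*) [CommRing R] {e g : E} (h : G.head e ≠ G.tail g) :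
    G.stepMatrix R e g = 0 := by
  simp [stepMatrix, h]

theorem map_pathGain {R R' : Type*} [CommRing R] [CommRing R'] (f : R →+* R') (P : List E) :
    MvPolynomial.map f (G.pathGain R P) = G.pathGain R' P := by
  induction P with
  | nil => simp [pathGain]
  | cons a l ih =>
    cases l with
    | nil => simp [pathGain]
    | cons b l =>
      rw [pathGain_cons_cons, pathGain_cons_cons, map_mul, ih]
      congr 1
      simp only [stepMatrix, Matrix.of_apply]
      split_ifs <;> simp

variable [Fintype E]

/-- The matrix of the sums of path gains. -/
noncomputable def pathMatrix (R : Type*) [CommRing R] : Matrix E E (MvPolynomial G.CodingVar R) :=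
  Matrix.of fun e e' => G.pathSum R e e'

theorem pathSum_eq_zero (R : Type*) [CommRing R] {e e' : E} (h : ¬ G.Reaches e e') :
    G.pathSum R e e' = 0 :=
  Finset.sum_eq_zero fun _ _ => if_neg fun hP => h hP.reaches

open Classical in
theorem pathSum_eq_sum (R : Type*) [CommRing R] {e e' : E} {s : Finset (List E)}
    (hs : ∀ P, P ∈ s ↔ G.IsPath e e' P) : G.pathSum R e e' = ∑ P ∈ s, G.pathGain R P := by
  rw [pathSum, ← Finset.sum_filter]
  refine Finset.sum_bij (fun P _ => P.1) ?_ ?_ ?_ ?_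
  · intro P hP
    exact (hs _).2 (Finset.mem_filter.1 hP).2
  · intro P _ P' _ h
    exact Subtype.ext h
  · intro P hP
    have := (hs P).1 hP
    exact ⟨⟨P, nodup_of_isChain this.1⟩, by simpa using this, rfl⟩
  · intros; rfl

open Classical in
/-- The finite set of all directed paths from `e` to `e'`. -/
noncomputable def pathFinset (e e' : E) : Finset (List E) :=
  (Finset.univ.filter fun P : {P : List E // P.Nodup} => G.IsPath e e' P.1).image Subtype.val

theorem mem_pathFinset {e e' : E} {P : List E} : P ∈ G.pathFinset e e' ↔ G.IsPath e e' P := by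
  classical
  simp only [pathFinset, Finset.mem_image, Finset.mem_filter, Finset.mem_univ, true_and]
  constructor
  · rintro ⟨P, h, rfl⟩
    exact h
  · intro h
    exact ⟨⟨P, nodup_of_isChain h.1⟩, h, rfl⟩

open Classical in
/-- A path is either a single edge or a first step followed by a path. -/
theorem pathSum_eq_add (R : Type*) [CommRing R] (e e' : E) :
    G.pathSum R e e' = (if e = e' then 1 else 0) +
      ∑ g, G.stepMatrix R e g * G.pathSum R g e' := by
  rw [G.pathSum_eq_sum R (fun _ => G.mem_pathFinset),
    ← Finset.sum_filter_add_sum_filter_not _ (fun P : List E => P = [e])]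
  congr 1
  · split_ifs with h
    · rw [show (G.pathFinset e e').filter (fun P => P = [e]) = {[e]} by
        ext P
        simp only [Finset.mem_filter, mem_pathFinset, Finset.mem_singleton, and_iff_right_iff_imp]
        rintro rfl
        exact isPath_singleton.2 ⟨rfl, h⟩]
      simp [pathGain]
    · refine Finset.sum_eq_zero fun P hP => ?_
      simp only [Finset.mem_filter, mem_pathFinset] at hP
      obtain ⟨hP, rfl⟩ := hP
      exact absurd (isPath_singleton.1 hP).2 h
  · have h1 : ∀ g, G.stepMatrix R e g * G.pathSum R g e' =
        ∑ P ∈ if G.head e = G.tail g then G.pathFinset g e' else ∅,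
          G.stepMatrix R e g * G.pathGain R P := by
      intro g
      split_ifs with h
      · rw [G.pathSum_eq_sum R (fun _ => G.mem_pathFinset), Finset.mul_sum]
      · simp [G.stepMatrix_of_ne R h]
    rw [Finset.sum_congr rfl fun g _ => h1 g, Finset.sum_sigma']
    symm
    refine Finset.sum_bij (fun x _ => e :: x.2) ?_ ?_ ?_ ?_
    · rintro ⟨g, P⟩ hP
      simp only [Finset.mem_sigma, Finset.mem_univ, true_and] at hP
      split_ifs at hP with h
      · rw [mem_pathFinset] at hP
        have h0 := hP.2.1
        cases P with
        | nil => simp at h0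
        | cons a l =>
          obtain rfl : a = g := by simpa using h0
          simpa [mem_pathFinset, isPath_cons_cons] using ⟨h, hP⟩
      · simp at hP
    · rintro ⟨g, P⟩ hP ⟨g', P'⟩ hP' hPP
      obtain rfl : P = P' := by simpa using hPP
      simp only [Finset.mem_sigma, Finset.mem_univ, true_and] at hP hP'
      split_ifs at hP hP'
      · rw [mem_pathFinset] at hP hP'
        have := hP.2.1.symm.trans hP'.2.1
        simp_all
      all_goals simp_all
    · intro P hP
      simp only [Finset.mem_filter, mem_pathFinset] at hP
      obtain ⟨hP, hne⟩ := hP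
      have h0 := hP.2.1
      match P, hP, hne with
      | [], hP, _ => simp at h0
      | [a], hP, hne => exact absurd (by rw [(isPath_singleton.1 hP).1]) hne
      | a :: b :: l, hP, _ =>
        obtain ⟨rfl, h, hP⟩ := isPath_cons_cons.1 hP
        exact ⟨⟨b, b :: l⟩, by simpa [h, mem_pathFinset] using hP, rfl⟩
    · rintro ⟨g, P⟩ hP
      simp only [Finset.mem_sigma, Finset.mem_univ, true_and] at hP
      split_ifs at hP with h
      · rw [mem_pathFinset] at hP
        have h0 := hP.2.1
        cases P with
        | nil => simp at h0
        | cons a l =>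
          obtain rfl : a = g := by simpa using h0
          rfl
      · simp at hP

theorem one_sub_stepMatrix_mul_pathMatrix (R : Type*) [CommRing R] [DecidableEq E] :
    (1 - G.stepMatrix R) * G.pathMatrix R = 1 := by
  ext1 e e'
  rw [sub_mul, one_mul, Matrix.sub_apply, Matrix.mul_apply]
  simp only [pathMatrix, Matrix.of_apply]
  rw [G.pathSum_eq_add R e e', add_sub_cancel_right, Matrix.one_apply]
  congr

theorem pathSum_self (R : Type*) [CommRing R] (e : E) : G.pathSum R e e = 1 := by
  rw [G.pathSum_eq_add, if_pos rfl, Finset.sum_eq_zero, add_zero]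
  intro g _
  by_cases h : G.head e = G.tail g
  · rw [G.pathSum_eq_zero R (not_reaches_of_consecutive h), mul_zero]
  · rw [G.stepMatrix_of_ne R h, zero_mul]

theorem map_pathSum {R R' : Type*} [CommRing R] [CommRing R'] (f : R →+* R') (e e' : E) :
    MvPolynomial.map f (G.pathSum R e e') = G.pathSum R' e e' := by
  rw [pathSum, pathSum, map_sum]
  refine Finset.sum_congr rfl fun P _ => ?_
  split_ifs
  · rw [map_pathGain]
  · simp

section Scaling

variable (R : Type*) [CommRing R]

open Classical in
/-- The substitution that multiplies the coding coefficients `x_{eg}` with `g ∈ T` by a new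
variable and leaves the other ones unchanged. -/
noncomputable def scaleHom (e : E) (T : Set E) :
    MvPolynomial G.CodingVar R →+* Polynomial (MvPolynomial G.CodingVar R) :=
  MvPolynomial.eval₂Hom (Polynomial.C.comp MvPolynomial.C) fun v =>
    (if v.1.1 = e ∧ v.1.2 ∈ T then Polynomial.X else 1) * Polynomial.C (MvPolynomial.X v)

open Classical in
/-- The sum of the gains of the continuations of the edge `e` to `e'` whose second edge lies
in `T`. -/
noncomputable def branchSum (e : E) (T : Set E) (e' : E) : MvPolynomial G.CodingVar R :=
  ∑ g, (if g ∈ T then G.stepMatrix R e g else 0) * G.pathSum R g e'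

/-- As a network has no cycles, a path uses at most one of the coding coefficients `x_{eg}`. So
scaling them perturbs the matrix of path sums by a matrix of rank one. -/
theorem scaleHom_pathSum (e : E) (T : Set E) (f f' : E) :
    G.scaleHom R e T (G.pathSum R f f') =
      Polynomial.C (G.pathSum R f f' - G.pathSum R f e * G.branchSum R e T f') +
        Polynomial.X * Polynomial.C (G.pathSum R f e * G.branchSum R e T f') := by
  classical
  set A := G.stepMatrix R with hA
  set N := G.pathMatrix R with hN
  set D : Matrix E E (MvPolynomial G.CodingVar R) :=
    Matrix.of fun a g => if a = e ∧ g ∈ T then A a g else 0 with hD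
  set c : MvPolynomial G.CodingVar R →+* Polynomial (MvPolynomial G.CodingVar R) := Polynomial.C
  have h1 : (1 - A) * N = 1 := G.one_sub_stepMatrix_mul_pathMatrix R
  have hDN : ∀ a b, (D * N) a b = if a = e then G.branchSum R e T b else 0 := by
    intro a b
    rw [Matrix.mul_apply]
    split_ifs with h
    · subst h
      simp [hD, hN, pathMatrix, branchSum, hA]
    · simp [hD, h]
  have hNDN : ∀ a b, (N * (D * N)) a b = G.pathSum R a e * G.branchSum R e T b := by
    intro a b
    rw [Matrix.mul_apply]
    simp only [hDN]
    simp [hN, pathMatrix]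
  have hDND : D * N * D = 0 := by
    ext1 a b
    rw [Matrix.mul_apply]
    refine Finset.sum_eq_zero fun g _ => ?_
    rw [hDN]
    by_cases ha : a = e
    · by_cases hg : g = e
      · rw [ha, hg]
        have : G.branchSum R e T e = 0 := by
          refine Finset.sum_eq_zero fun g _ => ?_
          by_cases h : G.head e = G.tail g
          · rw [G.pathSum_eq_zero R (not_reaches_of_consecutive h), mul_zero]
          · rw [G.stepMatrix_of_ne R h, ite_self, zero_mul]
        rw [this, ite_self, zero_mul]
      · simp [hD, hg]
    · simp [ha]
  have h2 : (G.scaleHom R e T).mapMatrix A =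
      c.mapMatrix A + (Polynomial.X - 1 : Polynomial (MvPolynomial G.CodingVar R)) •
        c.mapMatrix D := by
    ext1 a b
    simp only [RingHom.mapMatrix_apply, Matrix.map_apply, Matrix.add_apply, Matrix.smul_apply,
      hD, Matrix.of_apply, hA, stepMatrix, smul_eq_mul]
    by_cases h : G.head a = G.tail b
    · simp only [h, dif_pos, scaleHom, MvPolynomial.coe_eval₂Hom, MvPolynomial.eval₂_X]
      split_ifs
      · ring
      · simp [c]
    · simp [h]
  have h3 : (1 - (G.scaleHom R e T).mapMatrix A) * (G.scaleHom R e T).mapMatrix N = 1 := by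
    rw [← map_one (G.scaleHom R e T).mapMatrix, ← map_sub, ← map_mul, h1]
  have h4 : (1 - (G.scaleHom R e T).mapMatrix A) *
      (c.mapMatrix N + (Polynomial.X - 1 : Polynomial (MvPolynomial G.CodingVar R)) •
        c.mapMatrix (N * (D * N))) = 1 := by
    have e1 : (1 - c.mapMatrix A) * c.mapMatrix N = 1 := by
      rw [← map_one c.mapMatrix, ← map_sub, ← map_mul, h1]
    have e2 : c.mapMatrix D * c.mapMatrix (N * (D * N)) = 0 := by
      rw [← map_mul, ← mul_assoc, ← mul_assoc, hDND, zero_mul, map_zero]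
    have e3 : (1 - c.mapMatrix A) * c.mapMatrix (N * (D * N)) =
        c.mapMatrix D * c.mapMatrix N := by
      rw [map_mul, ← mul_assoc, e1, one_mul, map_mul]
    rw [h2, ← sub_sub, sub_mul, mul_add, mul_add, mul_smul_comm, mul_smul_comm, smul_mul_assoc,
      smul_mul_assoc, e1, e2, e3, smul_zero, smul_zero, add_zero, add_sub_cancel_right]
  have h5 : (G.scaleHom R e T).mapMatrix N =
      c.mapMatrix N + (Polynomial.X - 1 : Polynomial (MvPolynomial G.CodingVar R)) •
        c.mapMatrix (N * (D * N)) :=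
    left_inv_eq_right_inv (mul_eq_one_comm.1 h3) h4
  have h6 := congrFun (congrFun h5 f) f'
  simp only [RingHom.mapMatrix_apply, Matrix.map_apply, Matrix.add_apply, Matrix.smul_apply,
    hNDN, smul_eq_mul] at h6
  simp only [hN, pathMatrix, Matrix.of_apply] at h6
  rw [h6, map_sub]
  simp only [c]
  ring

theorem branchSum_singleton {e g : E} (h : G.head e = G.tail g) (e' : E) :
    G.branchSum R e {g} e' = MvPolynomial.X ⟨(e, g), h⟩ * G.pathSum R g e' := by
  classical
  rw [branchSum, Finset.sum_eq_single g]
  · simp [stepMatrix, h]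
  · intro b _ hb
    simp [hb]
  · simp

theorem branchSum_univ {e e' : E} (h : e ≠ e') :
    G.branchSum R e Set.univ e' = G.pathSum R e e' := by
  rw [G.pathSum_eq_add R e e', if_neg h, zero_add, branchSum]
  simp

theorem pathSum_ne_zero [IsDomain R] {e e' : E} (h : G.Reaches e e') : G.pathSum R e e' ≠ 0 := by
  induction h using Relation.ReflTransGen.head_induction_on with
  | refl => rw [G.pathSum_self]; exact one_ne_zero
  | @head a b hab _ ih =>
    intro h0
    have h1 := G.scaleHom_pathSum R a {b} a e'
    rw [G.pathSum_self, one_mul, G.branchSum_singleton R hab, h0, map_zero] at h1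
    have h2 := congrArg (fun p => Polynomial.coeff p 1) h1
    simp only [Polynomial.coeff_zero, Polynomial.coeff_add, Polynomial.coeff_C_succ, zero_add,
      Polynomial.coeff_X_mul, Polynomial.coeff_C_zero] at h2
    exact mul_ne_zero (MvPolynomial.X_ne_zero _) ih h2.symm

theorem pathSum_ne_zero_iff [IsDomain R] {e e' : E} :
    G.pathSum R e e' ≠ 0 ↔ G.Reaches e e' :=
  ⟨fun h => by_contra fun h' => h (G.pathSum_eq_zero R h'), G.pathSum_ne_zero R⟩

end Scaling

end PathSums

end Network

/-! ### A coding coefficient private to one session -/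

namespace SISOScenario

section RankOnePerturbation

variable {R : Type*} [CommRing R] [IsDomain R] {m : Fin 3 → Fin 3 → R} {a b : Fin 3 → R}

/-- The relation `m₁₂ m₂₃ m₃₁ + m₁₃ m₂₁ m₃₂ = m₁₁ m₂₃ m₃₂` between the entries of a `3 × 3`
matrix (written with indices in `Fin 3`). -/
def CrossRelation {R : Type*} [CommRing R] (m : Fin 3 → Fin 3 → R) : Prop :=
  m 0 1 * m 1 2 * m 2 0 + m 0 2 * m 1 0 * m 2 1 = m 0 0 * m 1 2 * m 2 1

/-- The entries of the pencil `(m - a bᵀ) + X a bᵀ`. -/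
noncomputable def rankOnePencil (m : Fin 3 → Fin 3 → R) (a b : Fin 3 → R) (j i : Fin 3) :
    Polynomial R :=
  Polynomial.C (m j i - a j * b i) + Polynomial.X * Polynomial.C (a j * b i)

omit [IsDomain R] in
theorem coeff_eq_zero_of_cubic {k₀ k₁ k₂ k₃ : R}
    (h : (Polynomial.C k₀ + Polynomial.C k₁ * Polynomial.X + Polynomial.C k₂ * Polynomial.X ^ 2 +
      Polynomial.C k₃ * Polynomial.X ^ 3 : Polynomial R) = 0) :
    k₁ = 0 ∧ k₂ = 0 ∧ k₃ = 0 := by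
  have h1 := congrArg (fun p => Polynomial.coeff p 1) h
  have h2 := congrArg (fun p => Polynomial.coeff p 2) h
  have h3 := congrArg (fun p => Polynomial.coeff p 3) h
  simp [Polynomial.coeff_C, Polynomial.coeff_X_pow] at h1 h2 h3
  exact ⟨h1, h2, h3⟩

omit [IsDomain R] in
/-- The coefficients of `X`, `X²` and `X³` in the cross relation of the pencil. -/
theorem CrossRelation.coeffs (h : CrossRelation (rankOnePencil m a b)) :
    let c := fun j i => m j i - a j * b i
    (a 0 * b 1 * c 1 2 * c 2 0 + c 0 1 * (a 1 * b 2) * c 2 0 + c 0 1 * c 1 2 * (a 2 * b 0) +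
        (a 0 * b 2 * c 1 0 * c 2 1 + c 0 2 * (a 1 * b 0) * c 2 1 + c 0 2 * c 1 0 * (a 2 * b 1)) -
        (a 0 * b 0 * c 1 2 * c 2 1 + c 0 0 * (a 1 * b 2) * c 2 1 + c 0 0 * c 1 2 * (a 2 * b 1))
      = 0) ∧
    (c 0 1 * (a 1 * b 2) * (a 2 * b 0) + a 0 * b 1 * c 1 2 * (a 2 * b 0) +
          a 0 * b 1 * (a 1 * b 2) * c 2 0 +
        (c 0 2 * (a 1 * b 0) * (a 2 * b 1) + a 0 * b 2 * c 1 0 * (a 2 * b 1) +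
          a 0 * b 2 * (a 1 * b 0) * c 2 1) -
        (c 0 0 * (a 1 * b 2) * (a 2 * b 1) + a 0 * b 0 * c 1 2 * (a 2 * b 1) +
          a 0 * b 0 * (a 1 * b 2) * c 2 1) = 0) ∧
    a 0 * a 1 * a 2 * (b 0 * b 1 * b 2) = 0 := by
  intro c
  refine coeff_eq_zero_of_cubic
    (k₀ := c 0 1 * c 1 2 * c 2 0 + c 0 2 * c 1 0 * c 2 1 - c 0 0 * c 1 2 * c 2 1) ?_
  unfold CrossRelation rankOnePencil at h
  simp only [map_sub, map_add, map_mul, c] at h ⊢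
  linear_combination h

variable (h : CrossRelation (rankOnePencil m a b)) (hm : ∀ j i, m j i ≠ 0)
include h hm

/-- A perturbation seen by sender `1` only: `b` is supported on receiver `1` or vanishes at neither
of the receivers `0` and `2`. The hypothesis `h'` excludes the pattern where `b 2` alone survives. -/
theorem CrossRelation.of_source_one (h' : m 0 1 * m 2 0 ≠ m 0 0 * m 2 1)
    (ha0 : a 0 = 0) (ha1 : a 1 ≠ 0) (ha2 : a 2 = 0) : b 0 = 0 ∧ b 2 = 0 ∨ b 0 ≠ 0 ∧ b 2 ≠ 0 := by
  obtain ⟨h1, -, -⟩ := h.coeffs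
  simp only [ha0, ha2, zero_mul, mul_zero, sub_zero, add_zero, zero_add] at h1
  by_cases hb0 : b 0 = 0
  · refine Or.inl ⟨hb0, by_contra fun hb2 => h' ?_⟩
    rw [hb0] at h1
    refine mul_left_cancel₀ (mul_ne_zero ha1 hb2) ?_
    linear_combination h1
  · refine Or.inr ⟨hb0, fun hb2 => ?_⟩
    rw [hb2] at h1
    exact mul_ne_zero (mul_ne_zero (hm 0 2) (mul_ne_zero ha1 hb0)) (hm 2 1)
      (by linear_combination h1)

theorem CrossRelation.of_sources_one_two (h' : m 0 2 * m 1 0 ≠ m 0 0 * m 1 2)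
    (ha0 : a 0 = 0) (ha1 : a 1 ≠ 0) (ha2 : a 2 ≠ 0) (hb1 : b 1 ≠ 0) : b 0 ≠ 0 ∧ b 2 ≠ 0 := by
  obtain ⟨h1, h2, -⟩ := h.coeffs
  simp only [ha0, zero_mul, sub_zero, add_zero, zero_add] at h1 h2
  by_cases hb0 : b 0 = 0 <;> by_cases hb2 : b 2 = 0
  · exfalso
    rw [hb0, hb2] at h1
    refine h' (mul_left_cancel₀ (mul_ne_zero ha2 hb1) ?_)
    linear_combination h1
  · exfalso
    rw [hb0] at h2
    exact mul_ne_zero (mul_ne_zero (hm 0 0) (mul_ne_zero ha1 hb2)) (mul_ne_zero ha2 hb1)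
      (by linear_combination -h2)
  · exfalso
    rw [hb2] at h2
    exact mul_ne_zero (mul_ne_zero (hm 0 2) (mul_ne_zero ha1 hb0)) (mul_ne_zero ha2 hb1)
      (by linear_combination h2)
  · exact ⟨hb0, hb2⟩

theorem CrossRelation.of_sources_zero_one
    (ha0 : a 0 ≠ 0) (ha1 : a 1 ≠ 0) (ha2 : a 2 = 0) (hb1 : b 1 ≠ 0) : b 0 ≠ 0 := by
  obtain ⟨h1, h2, -⟩ := h.coeffs
  simp only [ha2, zero_mul, mul_zero, sub_zero, add_zero, zero_add] at h1 h2
  intro hb0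
  by_cases hb2 : b 2 = 0
  · rw [hb0, hb2] at h1
    exact mul_ne_zero (mul_ne_zero (mul_ne_zero ha0 hb1) (hm 1 2)) (hm 2 0)
      (by linear_combination h1)
  · rw [hb0] at h2
    exact mul_ne_zero (mul_ne_zero (mul_ne_zero ha0 hb1) (mul_ne_zero ha1 hb2)) (hm 2 0)
      (by linear_combination h2)

/-- A perturbation seen by all senders cannot be seen by both of the receivers `0` and `1`: the
coefficient of `X³` forces `b 2 = 0`, and then two of the three monomials cancel in the coefficient
of `X²`. -/
theorem CrossRelation.of_all_sources
    (ha0 : a 0 ≠ 0) (ha1 : a 1 ≠ 0) (ha2 : a 2 ≠ 0) (hb1 : b 1 ≠ 0) : b 0 = 0 := by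
  obtain ⟨-, h2, h3⟩ := h.coeffs
  by_contra hb0
  have ha := mul_ne_zero (mul_ne_zero ha0 ha1) ha2
  have hb2 : b 2 = 0 := by
    rcases mul_eq_zero.1 h3 with h | h
    · exact absurd h ha
    · exact (mul_eq_zero.1 h).resolve_left (mul_ne_zero hb0 hb1)
  simp only [hb2, mul_zero, sub_zero] at h2
  exact mul_ne_zero (mul_ne_zero (hm 0 2) (mul_ne_zero ha1 hb0)) (mul_ne_zero ha2 hb1)
    (by linear_combination h2)

end RankOnePerturbation

theorem exists_step_of_reflTransGen {α : Type*} {r : α → α → Prop} {p : α → Prop} {x y : α}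
    (h : Relation.ReflTransGen r x y) (hx : p x) (hy : ¬ p y) :
    ∃ u v, r u v ∧ p u ∧ ¬ p v ∧ Relation.ReflTransGen r x u ∧ Relation.ReflTransGen r v y := by
  induction h using Relation.ReflTransGen.head_induction_on with
  | refl => exact absurd hx hy
  | @head a c hac hcy ih =>
    by_cases hc : p c
    · obtain ⟨u, v, h1, h2, h3, h4, h5⟩ := ih hc
      exact ⟨u, v, h1, h2, h3, .head hac h4, h5⟩
    · exact ⟨a, c, hac, hx, hc, .refl, hcy⟩

section FreeVariable

variable {V E : Type*} (S : SISOScenario V E)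

theorem reaches_of_fullyConnected {S : SISOScenario V E} (h : S.FullyConnected) (i j : Fin 3) :
    S.Reaches (S.σ i) (S.τ j) :=
  let ⟨_, hP⟩ := h i j
  hP.reaches

theorem σ_injective : Function.Injective S.σ := fun i j h =>
  S.s_injective (((S.tail_eq_s_iff i _).2 rfl).symm.trans
    ((congrArg S.tail h).trans ((S.tail_eq_s_iff j _).2 rfl)))

theorem τ_injective : Function.Injective S.τ := fun i j h =>
  S.d_injective (((S.head_eq_d_iff i _).2 rfl).symm.trans
    ((congrArg S.head h).trans ((S.head_eq_d_iff j _).2 rfl)))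

theorem eq_of_reaches_σ {e : E} {i : Fin 3} (h : S.Reaches e (S.σ i)) : e = S.σ i := by
  rcases Relation.ReflTransGen.cases_tail h with h | ⟨c, -, hc⟩
  · exact h.symm
  · exact absurd (hc.trans ((S.tail_eq_s_iff i _).2 rfl)) (S.head_ne_s i c)

theorem eq_of_τ_reaches {e : E} {i : Fin 3} (h : S.Reaches (S.τ i) e) : e = S.τ i := by
  rcases Relation.ReflTransGen.cases_head h with h | ⟨c, hc, -⟩
  · exact h.symm
  · exact absurd (hc.symm.trans ((S.head_eq_d_iff i _).2 rfl)) (S.tail_ne_d i c)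

variable [Fintype E]

/-- Some substitution of coding coefficients turns the transfer function of session `j` into a
polynomial of degree one in a new variable, and leaves the other transfer functions unchanged. -/
def HasFreeVariable (j : Fin 3) : Prop :=
  ∃ ψ : MvPolynomial S.CodingVar (ZMod 2) →+* Polynomial (MvPolynomial S.CodingVar (ZMod 2)),
    (∀ i k, ¬ (i = j ∧ k = j) →
      ψ (S.transfer (ZMod 2) i k) = Polynomial.C (S.transfer (ZMod 2) i k)) ∧
    ∃ c u, u ≠ 0 ∧ ψ (S.transfer (ZMod 2) j j) = Polynomial.C c + Polynomial.X * Polynomial.C u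

variable {S}

theorem CrossRelation.pencil (h : CrossRelation (S.transfer (ZMod 2))) (e : E) (T : Set E) :
    CrossRelation (rankOnePencil (S.transfer (ZMod 2)) (fun j => S.pathSum (ZMod 2) (S.σ j) e)
      fun i => S.branchSum (ZMod 2) e T (S.τ i)) := by
  have h' := congrArg (S.scaleHom (ZMod 2) e T) h
  simpa only [CrossRelation, transfer, map_add, map_mul, S.scaleHom_pathSum,
    rankOnePencil] using h'

theorem branchSum_singleton_ne_zero_iff {e g : E} (h : S.head e = S.tail g) (i : Fin 3) :
    S.branchSum (ZMod 2) e {g} (S.τ i) ≠ 0 ↔ S.Reaches g (S.τ i) := by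
  rw [S.branchSum_singleton (ZMod 2) h, mul_ne_zero_iff, S.pathSum_ne_zero_iff]
  exact and_iff_right (MvPolynomial.X_ne_zero _)

/-- The new variable scales a coding coefficient `x_{eg}` on a path from `σ 1` to `τ 1` such that `e`
is reached from no other sender and `g` leads to no other receiver. The edge `e` is the last one on
the path that is reached from `σ 1` only. If `g` led to another receiver, then walking on along the
path would end at an edge that is reached from all senders and leads to both `τ 0` and `τ 1`. -/
theorem hasFreeVariable_one (hconn : S.FullyConnected)
    (hrel : CrossRelation (S.transfer (ZMod 2)))
    (h1 : S.transfer (ZMod 2) 0 2 * S.transfer (ZMod 2) 1 0 ≠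
      S.transfer (ZMod 2) 0 0 * S.transfer (ZMod 2) 1 2)
    (h2 : S.transfer (ZMod 2) 0 1 * S.transfer (ZMod 2) 2 0 ≠
      S.transfer (ZMod 2) 0 0 * S.transfer (ZMod 2) 2 1) :
    S.HasFreeVariable 1 := by
  have hR := reaches_of_fullyConnected hconn
  have hm : ∀ j i, S.transfer (ZMod 2) j i ≠ 0 := fun j i => S.pathSum_ne_zero _ (hR j i)
  -- An edge reached from all senders cannot lead to both `τ 0` and `τ 1`.
  have hedge : ∀ g, S.Reaches (S.σ 0) g → S.Reaches (S.σ 1) g → S.Reaches (S.σ 2) g →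
      S.Reaches g (S.τ 1) → ¬ S.Reaches g (S.τ 0) := by
    intro g ha0 ha1 ha2 hb1 hb0
    have hg : ∀ i, (∃ k, k ≠ i ∧ S.Reaches g (S.τ k)) → g ≠ S.τ i := by
      rintro i ⟨k, hk, hgk⟩ rfl
      exact hk (S.τ_injective (S.eq_of_τ_reaches hgk))
    have := (hrel.pencil g Set.univ).of_all_sources hm (S.pathSum_ne_zero _ ha0)
      (S.pathSum_ne_zero _ ha1) (S.pathSum_ne_zero _ ha2)
      (by rw [S.branchSum_univ _ (hg 1 ⟨0, by decide, hb0⟩)]; exact S.pathSum_ne_zero _ hb1)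
    rw [S.branchSum_univ _ (hg 0 ⟨1, by decide, hb1⟩)] at this
    exact S.pathSum_ne_zero _ hb0 this
  obtain ⟨e, g, heg, ⟨he0, he2⟩, hg, h1e, hg1⟩ := exists_step_of_reflTransGen
    (p := fun e => ¬ S.Reaches (S.σ 0) e ∧ ¬ S.Reaches (S.σ 2) e) (hR 1 1)
    ⟨fun h => absurd (S.σ_injective (S.eq_of_reaches_σ h)) (by decide),
      fun h => absurd (S.σ_injective (S.eq_of_reaches_σ h)) (by decide)⟩
    (fun h => h.1 (hR 0 1))
  have h1g : S.Reaches (S.σ 1) g := h1e.tail heg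
  rcases (hrel.pencil e {g}).of_source_one hm h2 (S.pathSum_eq_zero _ he0)
    (S.pathSum_ne_zero _ h1e) (S.pathSum_eq_zero _ he2) with ⟨hb0, hb2⟩ | ⟨hb0, hb2⟩
  · refine ⟨S.scaleHom (ZMod 2) e {g}, ?_, _, _, ?_, S.scaleHom_pathSum (ZMod 2) e {g} _ _⟩
    · intro i k hik
      have : S.pathSum (ZMod 2) (S.σ i) e * S.branchSum (ZMod 2) e {g} (S.τ k) = 0 := by
        rw [mul_eq_zero]
        fin_cases i
        · exact Or.inl (S.pathSum_eq_zero _ he0)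
        · fin_cases k
          · exact Or.inr hb0
          · exact absurd ⟨rfl, rfl⟩ hik
          · exact Or.inr hb2
        · exact Or.inl (S.pathSum_eq_zero _ he2)
      rw [transfer, S.scaleHom_pathSum, this]
      simp
    · exact mul_ne_zero (S.pathSum_ne_zero _ h1e) ((branchSum_singleton_ne_zero_iff heg 1).2 hg1)
  · exfalso
    rw [branchSum_singleton_ne_zero_iff heg] at hb0 hb2
    by_cases hg0 : S.Reaches (S.σ 0) g
    · have hg2 : ¬ S.Reaches (S.σ 2) g := fun hg2 => hedge g hg0 h1g hg2 hg1 hb0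
      obtain ⟨h, h', hh, ⟨hh0, hh1, hh2, -⟩, hn, -, hh'⟩ := exists_step_of_reflTransGen
        (p := fun h => S.Reaches (S.σ 0) h ∧ S.Reaches (S.σ 1) h ∧ ¬ S.Reaches (S.σ 2) h ∧
          S.Reaches h (S.τ 0)) hg1 ⟨hg0, h1g, hg2, hb0⟩ (fun h => h.2.2.1 (hR 2 1))
      have hb0' := (branchSum_singleton_ne_zero_iff hh 0).1
        ((hrel.pencil h {h'}).of_sources_zero_one hm (S.pathSum_ne_zero _ hh0)
          (S.pathSum_ne_zero _ hh1) (S.pathSum_eq_zero _ hh2)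
          ((branchSum_singleton_ne_zero_iff hh 1).2 hh'))
      refine hedge h' (hh0.tail hh) (hh1.tail hh) ?_ hh' hb0'
      by_contra hh2'
      exact hn ⟨hh0.tail hh, hh1.tail hh, hh2', hb0'⟩
    · have hg2 : S.Reaches (S.σ 2) g := by
        by_contra hg2
        exact hg ⟨hg0, hg2⟩
      obtain ⟨h, h', hh, ⟨hh0, hh1, hh2, -⟩, hn, -, hh'⟩ := exists_step_of_reflTransGen
        (p := fun h => ¬ S.Reaches (S.σ 0) h ∧ S.Reaches (S.σ 1) h ∧ S.Reaches (S.σ 2) h ∧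
          S.Reaches h (S.τ 0)) hg1 ⟨hg0, h1g, hg2, hb0⟩ (fun h => h.1 (hR 0 1))
      have hb0' := (branchSum_singleton_ne_zero_iff hh 0).1
        ((hrel.pencil h {h'}).of_sources_one_two hm h1 (S.pathSum_eq_zero _ hh0)
          (S.pathSum_ne_zero _ hh1) (S.pathSum_ne_zero _ hh2)
          ((branchSum_singleton_ne_zero_iff hh 1).2 hh')).1
      refine hedge h' ?_ (hh1.tail hh) (hh2.tail hh) hh' hb0'
      by_contra hh0'
      exact hn ⟨hh0', hh1.tail hh, hh2.tail hh, hb0'⟩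

theorem hasFreeVariable_two (hconn : S.FullyConnected)
    (hrel : CrossRelation (S.transfer (ZMod 2)))
    (h1 : S.transfer (ZMod 2) 0 2 * S.transfer (ZMod 2) 1 0 ≠
      S.transfer (ZMod 2) 0 0 * S.transfer (ZMod 2) 1 2)
    (h2 : S.transfer (ZMod 2) 0 1 * S.transfer (ZMod 2) 2 0 ≠
      S.transfer (ZMod 2) 0 0 * S.transfer (ZMod 2) 2 1) :
    S.HasFreeVariable 2 := by
  -- The cross relation is symmetric in the sessions `1` and `2`.
  have hrel' : CrossRelation ((S.relabel (Equiv.swap 1 2)).transfer (ZMod 2)) := by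
    change S.transfer (ZMod 2) 0 2 * S.transfer (ZMod 2) 2 1 * S.transfer (ZMod 2) 1 0 +
      S.transfer (ZMod 2) 0 1 * S.transfer (ZMod 2) 2 0 * S.transfer (ZMod 2) 1 2 =
      S.transfer (ZMod 2) 0 0 * S.transfer (ZMod 2) 2 1 * S.transfer (ZMod 2) 1 2
    unfold CrossRelation at hrel
    linear_combination hrel
  obtain ⟨ψ, hψ, c, u, hu, hc⟩ := hasFreeVariable_one (S := S.relabel (Equiv.swap 1 2))
    (fun i j => hconn _ _) hrel' h2 h1
  refine ⟨ψ, fun i k hik => ?_, c, u, hu, hc⟩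
  have := hψ (Equiv.swap 1 2 i) (Equiv.swap 1 2 k)
  have e : (S.relabel (Equiv.swap 1 2)).transfer (ZMod 2) (Equiv.swap 1 2 i)
      (Equiv.swap 1 2 k) = S.transfer (ZMod 2) i k := by
    simp [transfer, relabel]
  rw [e] at this
  have hswap : ∀ i k : Fin 3, Equiv.swap (1 : Fin 3) 2 i = 1 ∧ Equiv.swap (1 : Fin 3) 2 k = 1 →
      i = 2 ∧ k = 2 := by decide
  exact this fun h => hik (hswap i k h)

end FreeVariable

end SISOScenario

/-! ### Probability of the non-vanishing of a polynomial -/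

section Probability

open MvPolynomial

variable {ι : Type*} [Finite ι]

/-- The Schwartz–Zippel bound, uniformly in the field with `2 ^ m` elements. -/
theorem card_aeval_eq_zero_div_card_le {F : MvPolynomial ι (ZMod 2)} (hF : F ≠ 0) {m : ℕ}
    (hm : m ≠ 0) :
    (Nat.card {ξ : ι → GaloisField 2 m // aeval ξ F = 0} : ℝ) /
      (Nat.card (ι → GaloisField 2 m) : ℝ) ≤ (F.totalDegree : ℝ) / 2 ^ m := by
  classical
  have : Fintype (GaloisField 2 m) := Fintype.ofFinite _
  obtain ⟨n, ⟨e⟩⟩ := Finite.exists_equiv_fin ι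
  set p : MvPolynomial (Fin n) (GaloisField 2 m) :=
    rename e (map (algebraMap (ZMod 2) (GaloisField 2 m)) F) with hp
  have hp0 : p ≠ 0 := by
    rw [hp, Ne, map_eq_zero_iff _ (rename_injective _ e.injective),
      map_eq_zero_iff _ (map_injective _ (algebraMap (ZMod 2) (GaloisField 2 m)).injective)]
    exact hF
  have hdeg : p.totalDegree ≤ F.totalDegree :=
    (totalDegree_rename_le _ _).trans (Finset.sup_mono (support_map_subset _ _))
  have hcard : (Finset.univ : Finset (GaloisField 2 m)).card = 2 ^ m := by
    rw [Finset.card_univ, ← Nat.card_eq_fintype_card, GaloisField.card 2 m hm]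
  have h1 := schwartz_zippel_totalDegree hp0 (Finset.univ : Finset (GaloisField 2 m))
  have heq : Nat.card {ξ : ι → GaloisField 2 m // aeval ξ F = 0} =
      (Finset.univ.filter fun f : Fin n → GaloisField 2 m => eval f p = 0).card := by
    rw [Nat.card_congr (Equiv.subtypeEquiv (q := fun f : Fin n → GaloisField 2 m =>
      eval f p = 0) (Equiv.arrowCongr e (Equiv.refl _)) fun ξ => ?_)]
    · rw [Nat.card_eq_fintype_card, Fintype.card_subtype]
    · rw [hp, eval_rename, eval_map, aeval_def]
      have : (Equiv.arrowCongr e (Equiv.refl (GaloisField 2 m))) ξ ∘ e = ξ := by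
        ext i
        simp
      rw [this]
  have hall : Nat.card (ι → GaloisField 2 m) = (2 ^ m) ^ n := by
    rw [Nat.card_congr (Equiv.arrowCongr e (Equiv.refl (GaloisField 2 m))), Nat.card_fun,
      GaloisField.card 2 m hm, Nat.card_eq_fintype_card, Fintype.card_fin]
  rw [Fintype.piFinset_univ, hcard] at h1
  rw [heq, hall]
  have h2 : ((Finset.univ.filter fun f : Fin n → GaloisField 2 m => eval f p = 0).card : ℝ) /
      (((2 ^ m : ℕ) : ℝ) ^ n) ≤ (p.totalDegree : ℝ) / ((2 ^ m : ℕ) : ℝ) := by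
    have := (NNRat.cast_le (K := ℝ)).2 h1
    push_cast at this ⊢
    exact this
  push_cast at h2 ⊢
  refine h2.trans ?_
  gcongr

theorem tendsto_const_div_two_pow (d : ℝ) : Tendsto (fun m : ℕ => d / 2 ^ m) atTop (𝓝 0) :=
  tendsto_const_nhds.div_atTop (tendsto_pow_atTop_atTop_of_one_lt one_lt_two)

/-- An event that contains the non-vanishing of a fixed nonzero polynomial has asymptotic
probability one. -/
theorem tendsto_card_div_card_one {F : MvPolynomial ι (ZMod 2)} (hF : F ≠ 0)
    {p : (m : ℕ) → (ι → GaloisField 2 m) → Prop}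
    (hp : ∀ m ξ, m ≠ 0 → aeval ξ F ≠ 0 → p m ξ) :
    Tendsto (fun m => (Nat.card {ξ : ι → GaloisField 2 m // p m ξ} : ℝ) /
      (Nat.card (ι → GaloisField 2 m) : ℝ)) atTop (𝓝 1) := by
  have hpos : ∀ m, (0 : ℝ) < Nat.card (ι → GaloisField 2 m) := fun m => by
    exact_mod_cast Nat.card_pos
  have h1 : Tendsto (fun m : ℕ => 1 - (F.totalDegree : ℝ) / 2 ^ m) atTop (𝓝 1) := by
    simpa using (tendsto_const_div_two_pow (F.totalDegree : ℝ)).const_sub 1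
  refine tendsto_of_tendsto_of_tendsto_of_le_of_le' h1 tendsto_const_nhds ?_ ?_
  · filter_upwards [eventually_ne_atTop 0] with m hm
    have h2 := card_aeval_eq_zero_div_card_le hF hm
    have h3 : Nat.card (ι → GaloisField 2 m) ≤
        Nat.card {ξ : ι → GaloisField 2 m // aeval ξ F = 0} +
          Nat.card {ξ : ι → GaloisField 2 m // p m ξ} := by
      classical
      have := Fintype.ofFinite (ι → GaloisField 2 m)
      rw [Nat.card_eq_fintype_card, Nat.card_eq_fintype_card, Nat.card_eq_fintype_card,
        Fintype.card_subtype, Fintype.card_subtype, ← Finset.card_univ]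
      refine (Finset.card_le_card ?_).trans (Finset.card_union_le _ _)
      intro ξ _
      by_cases h : aeval ξ F = 0
      · simp [h]
      · simp [hp m ξ hm h]
    rw [div_le_iff₀ (hpos m)] at h2
    rw [le_div_iff₀ (hpos m)]
    have h4 : (Nat.card (ι → GaloisField 2 m) : ℝ) ≤
        Nat.card {ξ : ι → GaloisField 2 m // aeval ξ F = 0} +
          Nat.card {ξ : ι → GaloisField 2 m // p m ξ} := by exact_mod_cast h3
    linarith
  · filter_upwards with m
    refine div_le_one_of_le₀ ?_ (hpos m).le
    exact_mod_cast Nat.card_le_card_of_injective _ Subtype.val_injective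

/-- An event of asymptotic probability one meets the non-vanishing of any nonzero polynomial. -/
theorem exists_aeval_ne_zero_of_tendsto {F : MvPolynomial ι (ZMod 2)} (hF : F ≠ 0)
    {p : (m : ℕ) → (ι → GaloisField 2 m) → Prop}
    (hp : Tendsto (fun m => (Nat.card {ξ : ι → GaloisField 2 m // p m ξ} : ℝ) /
      (Nat.card (ι → GaloisField 2 m) : ℝ)) atTop (𝓝 1)) :
    ∃ m ξ, p m ξ ∧ aeval ξ F ≠ 0 := by
  by_contra! hcon
  have : (1 : ℝ) ≤ 0 := by
    refine le_of_tendsto_of_tendsto hp (tendsto_const_div_two_pow (F.totalDegree : ℝ)) ?_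
    filter_upwards [eventually_ne_atTop 0] with m hm
    refine le_trans ?_ (card_aeval_eq_zero_div_card_le hF hm)
    gcongr
    exact Nat.card_le_card_of_injective
      (fun ξ : {ξ : ι → GaloisField 2 m // p m ξ} =>
        (⟨ξ.1, hcon m ξ.1 ξ.2⟩ : {ξ : ι → GaloisField 2 m // aeval ξ F = 0}))
      fun ξ ξ' h => Subtype.ext (congrArg (fun x => x.1) h)
  linarith

end Probability

/-! ### Values of rational functions -/

namespace PrecodingScheme

/-- Writing a rational function in lowest terms does not change its value at a point where some
denominator does not vanish. -/
theorem definedAt_and_evalAt_div {ι K : Type*} [Field K] (ξ : ι → K) {a b : MvPolynomial ι K}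
    (hb : MvPolynomial.eval ξ b ≠ 0) {f : FractionRing (MvPolynomial ι K)}
    (hf : f = algebraMap _ _ a / algebraMap _ _ b) :
    DefinedAt ξ f ∧ evalAt ξ f = MvPolynomial.eval ξ a / MvPolynomial.eval ξ b := by
  set n := IsFractionRing.num (MvPolynomial ι K) f with hn
  set d : MvPolynomial ι K := ↑(IsFractionRing.den (MvPolynomial ι K) f) with hd
  have hb0 : b ≠ 0 := by
    rintro rfl
    simp at hb
  have hd0 : d ≠ 0 := nonZeroDivisors.coe_ne_zero _
  have hinj := IsFractionRing.injective (MvPolynomial ι K) (FractionRing (MvPolynomial ι K))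
  have h1 : n * b = a * d := by
    apply hinj
    have h2 := IsFractionRing.mk'_num_den' (MvPolynomial ι K) f
    rw [← hn, ← hd, hf, div_eq_div_iff ((map_ne_zero_iff _ hinj).2 hd0)
      ((map_ne_zero_iff _ hinj).2 hb0)] at h2
    rw [map_mul, map_mul, h2]
  have h3 : d ∣ b :=
    (IsFractionRing.num_den_reduced (MvPolynomial ι K) f).symm.dvd_of_dvd_mul_left
      ⟨a, by rw [← hn, ← hd, h1, mul_comm]⟩
  have h4 : MvPolynomial.eval ξ d ≠ 0 := by
    obtain ⟨c, rfl⟩ := h3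
    rw [map_mul] at hb
    exact left_ne_zero_of_mul hb
  refine ⟨h4, ?_⟩
  rw [evalAt, div_eq_div_iff h4 hb, ← map_mul, ← map_mul, h1]

end PrecodingScheme

/-! ### Independence over generic time slots -/

section SlotPolynomials

open MvPolynomial

variable {σ : Type*} {N q : ℕ}

/-- The copy of a polynomial in the variables of the time slot `t`. -/
noncomputable def slotCopy (N q : ℕ) (t : Fin N) :
    MvPolynomial σ (ZMod 2) →+* MvPolynomial ((Fin N × σ) ⊕ Fin q) (ZMod 2) :=
  (rename fun v => Sum.inl (t, v)).toRingHom

theorem slotCopy_X (t : Fin N) (v : σ) : slotCopy N q t (X v) = X (Sum.inl (t, v)) :=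
  rename_X _ _

theorem slotCopy_ne_zero {P : MvPolynomial σ (ZMod 2)} (hP : P ≠ 0) (t : Fin N) :
    slotCopy N q t P ≠ 0 :=
  (map_ne_zero_iff (slotCopy N q t) (rename_injective _ fun v w h => by simpa using h)).2 hP

/-- Two ratios in disjoint sets of variables agree only if they are constant; and `0` and `1` are
the only constants of `𝔽₂`. -/
theorem slotCopy_mul_ne {P Q : MvPolynomial σ (ZMod 2)} (hP : P ≠ 0) (hQ : Q ≠ 0) (hPQ : P ≠ Q)
    {s t : Fin N} (hst : s ≠ t) :
    slotCopy N q s P * slotCopy N q t Q ≠ slotCopy N q t P * slotCopy N q s Q := by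
  intro h
  -- Slot `s` supplies the variables, slot `t` the coefficients.
  let Θ : MvPolynomial ((Fin N × σ) ⊕ Fin q) (ZMod 2) →+*
      MvPolynomial σ (MvPolynomial σ (ZMod 2)) :=
    eval₂Hom (C.comp C) (Sum.elim (fun x => if x.1 = s then X x.2 else C (X x.2)) fun _ => 0)
  have hs : ∀ p, Θ (slotCopy N q s p) = map C p := by
    intro p
    refine congrFun (congrArg DFunLike.coe (ringHom_ext (f := Θ.comp (slotCopy N q s))
      (g := map C) (fun r => ?_) fun v => ?_)) p
    · simp [Θ, slotCopy]
    · simp [Θ, slotCopy_X]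
  have ht : ∀ p, Θ (slotCopy N q t p) = C p := by
    intro p
    refine congrFun (congrArg DFunLike.coe (ringHom_ext (f := Θ.comp (slotCopy N q t))
      (g := C) (fun r => ?_) fun v => ?_)) p
    · simp [Θ, slotCopy]
    · simp [Θ, slotCopy_X, hst.symm]
  have h1 := congrArg Θ h
  rw [map_mul, map_mul, hs, hs, ht, ht] at h1
  obtain ⟨μ, hμ⟩ := ne_zero_iff.1 hQ
  have h2 := congrArg (coeff μ) h1
  rw [mul_comm, coeff_C_mul, coeff_C_mul, coeff_map, coeff_map] at h2
  have h01 : ∀ x : ZMod 2, x = 0 ∨ x = 1 := by decide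
  rw [(h01 _).resolve_left hμ, C_1, mul_one] at h2
  rcases h01 (coeff μ P) with h3 | h3
  · rw [h3, C_0, mul_zero] at h2
    exact hP h2.symm
  · rw [h3, C_1, mul_one] at h2
    exact hPQ h2.symm

/-- The matrix with the rows `(r q, r p, q², q p, p²)`. With `p / q = η` it has, up to row factors,
the columns `(r / q) (1, η)` and `(1, η, η²)`. -/
def pairingMatrix {B : Type*} [CommRing B] (p q r : Fin 5 → B) : Matrix (Fin 5) (Fin 5) B :=
  Matrix.of fun t => ![r t * q t, r t * p t, q t ^ 2, q t * p t, p t ^ 2]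

theorem map_det_pairingMatrix {B B' : Type*} [CommRing B] [CommRing B'] (f : B →+* B')
    (p q r : Fin 5 → B) : f (pairingMatrix p q r).det =
      (pairingMatrix (fun t => f (p t)) (fun t => f (q t)) fun t => f (r t)).det := by
  rw [RingHom.map_det]
  congr 1
  ext t c
  fin_cases c <;> simp [pairingMatrix]

/-- With `r = (0, 0, 0, 1, 1)` the matrix is block triangular with Vandermonde blocks. -/
theorem det_pairingMatrix_ne_zero {B : Type*} [Field B] {p q r : Fin 5 → B} (hq : ∀ t, q t ≠ 0)
    (hpq : Function.Injective fun t => p t / q t) (h0 : r 0 = 0) (h1 : r 1 = 0) (h2 : r 2 = 0)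
    (h3 : r 3 = 1) (h4 : r 4 = 1) : (pairingMatrix p q r).det ≠ 0 := by
  intro hdet
  obtain ⟨v, hv, hMv⟩ := Matrix.exists_mulVec_eq_zero_iff.2 hdet
  apply hv
  have hrow : ∀ t, r t * q t * v 0 + r t * p t * v 1 + q t ^ 2 * v 2 + q t * p t * v 3 +
      p t ^ 2 * v 4 = 0 := fun t => by
    have := congrFun hMv t
    simpa [pairingMatrix, Matrix.mulVec, dotProduct, Fin.sum_univ_five] using this
  have hp : ∀ t, p t = q t * (p t / q t) := fun t => by field_simp [hq t]
  have hA : (![v 2, v 3, v 4] : Fin 3 → B) = 0 := by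
    refine Matrix.eq_zero_of_forall_index_sum_pow_mul_eq_zero
      (f := fun i : Fin 3 => p (Fin.castLE (by omega) i) / q (Fin.castLE (by omega) i))
      (hpq.comp (Fin.castLE_injective (by omega : 3 ≤ 5))) fun j => ?_
    have hr : r (Fin.castLE (by omega) j) = 0 := by fin_cases j <;> assumption
    have := hrow (Fin.castLE (by omega) j)
    rw [hr, hp] at this
    refine (mul_eq_zero.1 (?_ : q (Fin.castLE (by omega) j) ^ 2 * _ = 0)).resolve_left
      (pow_ne_zero 2 (hq _))
    simp only [Fin.sum_univ_three, Fin.val_zero, Fin.val_one, Fin.val_two, cons_val]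
    linear_combination this
  have e2 : v 2 = 0 := congrFun hA 0
  have e3 : v 3 = 0 := congrFun hA 1
  have e4 : v 4 = 0 := congrFun hA 2
  have hB : (![v 0, v 1] : Fin 2 → B) = 0 := by
    refine Matrix.eq_zero_of_forall_index_sum_pow_mul_eq_zero
      (f := fun i : Fin 2 => p (Fin.natAdd 3 i) / q (Fin.natAdd 3 i))
      (hpq.comp (Fin.natAdd_injective 2 3)) fun j => ?_
    have hr : r (Fin.natAdd 3 j) = 1 := by fin_cases j <;> assumption
    have := hrow (Fin.natAdd 3 j)
    rw [hr, hp, e2, e3, e4] at this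
    refine (mul_eq_zero.1 (?_ : q (Fin.natAdd 3 j) * _ = 0)).resolve_left (hq _)
    simp only [Fin.sum_univ_two, Fin.val_zero, Fin.val_one, cons_val]
    linear_combination this
  have e0 : v 0 = 0 := congrFun hB 0
  have e1 : v 1 = 0 := congrFun hB 1
  ext i
  fin_cases i <;> assumption

/-- If some substitution moves `R` and fixes `P` and `Q`, then the functions `R Q, R P, Q², Q P, P²`
are linearly independent in the strong sense that five generic points make their matrix
nonsingular. -/
theorem det_pairingMatrix_slotCopy_ne_zero {P Q R : MvPolynomial σ (ZMod 2)} (hP : P ≠ 0)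
    (hQ : Q ≠ 0) (hPQ : P ≠ Q)
    {ψ : MvPolynomial σ (ZMod 2) →+* Polynomial (MvPolynomial σ (ZMod 2))}
    (hψP : ψ P = Polynomial.C P) (hψQ : ψ Q = Polynomial.C Q) {c u : MvPolynomial σ (ZMod 2)}
    (hu : u ≠ 0) (hψR : ψ R = Polynomial.C c + Polynomial.X * Polynomial.C u) :
    (pairingMatrix (fun t => slotCopy 5 q t P) (fun t => slotCopy 5 q t Q)
      fun t => slotCopy 5 q t R).det ≠ 0 := by
  let A := MvPolynomial ((Fin 5 × σ) ⊕ Fin q) (ZMod 2)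
  let B := FractionRing A
  let i : A →+* B := algebraMap A B
  have hi : Function.Injective i := IsFractionRing.injective A B
  let g (t : Fin 5) : MvPolynomial σ (ZMod 2) →+* B := i.comp (slotCopy 5 q t)
  have hg : ∀ t {p}, p ≠ 0 → g t p ≠ 0 := fun t p hp =>
    (map_ne_zero_iff i hi).2 (slotCopy_ne_zero hp t)
  -- The new variable is chosen such that `R` becomes `ρ t` in the slot `t`.
  let ρ : Fin 5 → B := ![0, 0, 0, 1, 1]
  let l (t : Fin 5) : B := (ρ t - g t c) / g t u
  let f (t : Fin 5) : MvPolynomial σ (ZMod 2) →+* B :=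
    (Polynomial.eval₂RingHom (g t) (l t)).comp ψ
  let Φ : A →+* B := eval₂Hom (i.comp C) (Sum.elim (fun x => f x.1 (X x.2)) fun _ => 0)
  have hΦ : ∀ t p, Φ (slotCopy 5 q t p) = f t p := by
    intro t p
    refine congrFun (congrArg DFunLike.coe (ringHom_ext' (f := Φ.comp (slotCopy 5 q t))
      (g := f t) (Subsingleton.elim _ _) fun v => ?_)) p
    rw [RingHom.comp_apply, slotCopy_X]
    exact eval₂_X _ _ _
  have hfP : ∀ t, f t P = g t P := fun t => by simp [f, hψP]
  have hfQ : ∀ t, f t Q = g t Q := fun t => by simp [f, hψQ]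
  have hfR : ∀ t, f t R = ρ t := fun t => by
    have := hg t hu
    simp only [f, RingHom.comp_apply, hψR, map_add, map_mul, Polynomial.coe_eval₂RingHom,
      Polynomial.eval₂_C, Polynomial.eval₂_X, l]
    rw [div_mul_cancel₀ _ this]
    ring
  intro hdet
  have h := map_det_pairingMatrix Φ (fun t => slotCopy 5 q t P) (fun t => slotCopy 5 q t Q)
    fun t => slotCopy 5 q t R
  rw [hdet, map_zero] at h
  simp only [hΦ, hfP, hfQ, hfR] at h
  refine det_pairingMatrix_ne_zero (fun t => hg t hQ) ?_ rfl rfl rfl rfl rfl h.symm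
  intro s t hst
  by_contra hne
  refine slotCopy_mul_ne (q := q) hP hQ hPQ hne (hi ?_)
  have := (div_eq_div_iff (hg s hQ) (hg t hQ)).1 hst
  simpa [g] using this

end SlotPolynomials

/-! ### The outer bound and renumbering of the sessions -/

section OuterBound

/-- If every receiver decodes, then, as subspaces of the signals of session `0`, the signals that
are aligned at receiver `1` with session `2` and those that are aligned at receiver `2` with
session `1` intersect trivially, because the cross relation would align the intersection with the
interference at receiver `0`. -/
theorem two_mul_sum_le_of_decodable {K : Type*} [Field K] {N : ℕ} {k : Fin 3 → ℕ}
    {μ : Fin N → Fin 3 → Fin 3 → K} {W : (j : Fin 3) → Matrix (Fin N) (Fin (k j)) K}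
    (hrel : ∀ t, SISOScenario.CrossRelation (μ t)) (h12 : ∀ t, μ t 1 2 ≠ 0)
    (h21 : ∀ t, μ t 2 1 ≠ 0)
    (hdec : ∀ (i : Fin 3) (X : (j : Fin 3) → Fin (k j) → K),
      (∀ t, ∑ j, μ t j i * (W j *ᵥ X j) t = 0) → X i = 0) :
    2 * (k 0 + k 1 + k 2) ≤ k 0 + 2 * N := by
  let L (i : Fin 3) : ((j : Fin 3) → Fin (k j) → K) →ₗ[K] (Fin N → K) :=
    { toFun := fun X t => ∑ j, μ t j i * (W j *ᵥ X j) t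
      map_add' := fun X Y => by
        ext t
        simp [Matrix.mulVec_add, mul_add, Finset.sum_add_distrib]
      map_smul' := fun c X => by
        ext t
        simp only [Pi.smul_apply, Matrix.mulVec_smul, smul_eq_mul, RingHom.id_apply,
          Finset.mul_sum]
        exact Finset.sum_congr rfl fun j _ => by ring }
  have hker : ∀ i, k 0 + k 1 + k 2 ≤ N + Module.finrank K (LinearMap.ker (L i)) := by
    intro i
    have h1 := (L i).finrank_range_add_finrank_ker
    have h2 : Module.finrank K (LinearMap.range (L i)) ≤ N := by
      simpa using Submodule.finrank_le (LinearMap.range (L i))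
    rw [Module.finrank_pi_fintype, Fin.sum_univ_three] at h1
    simp only [Module.finrank_fin_fun] at h1
    omega
  let D : (LinearMap.ker (L 1) × LinearMap.ker (L 2)) →ₗ[K] (Fin (k 0) → K) :=
    (LinearMap.proj 0 ∘ₗ (LinearMap.ker (L 1)).subtype).comp (LinearMap.fst K _ _) -
      (LinearMap.proj 0 ∘ₗ (LinearMap.ker (L 2)).subtype).comp (LinearMap.snd K _ _)
  have hD : Function.Injective D := by
    rw [injective_iff_map_eq_zero]
    rintro ⟨⟨Y, hY⟩, ⟨Y', hY'⟩⟩ h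
    have h0 : Y 0 = Y' 0 := sub_eq_zero.1 h
    have hYt : ∀ t, ∑ j, μ t j 1 * (W j *ᵥ Y j) t = 0 := fun t => congrFun hY t
    have hYt' : ∀ t, ∑ j, μ t j 2 * (W j *ᵥ Y' j) t = 0 := fun t => congrFun hY' t
    have hY1 : Y 1 = 0 := hdec 1 Y hYt
    have hY2' : Y' 2 = 0 := hdec 2 Y' hYt'
    have hY0 : Y 0 = 0 := by
      refine hdec 0 (fun j => if j = 1 then Y' j else Y j) fun t => ?_
      have e1 := hYt t
      have e2 := hYt' t
      have e3 : μ t 0 1 * μ t 1 2 * μ t 2 0 + μ t 0 2 * μ t 1 0 * μ t 2 1 =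
        μ t 0 0 * μ t 1 2 * μ t 2 1 := hrel t
      simp only [Fin.sum_univ_three, hY1, hY2', ← h0, Matrix.mulVec_zero, Pi.zero_apply,
        mul_zero, add_zero] at e1 e2
      simp only [Fin.sum_univ_three, Fin.isValue, zero_ne_one, if_false, if_true,
        show (2 : Fin 3) ≠ 1 by decide]
      refine mul_left_cancel₀ (mul_ne_zero (h12 t) (h21 t)) ?_
      linear_combination -(W 0 *ᵥ Y 0) t * e3 + μ t 2 0 * μ t 1 2 * e1 + μ t 1 0 * μ t 2 1 * e2
    have hY2 : Y 2 = 0 := by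
      refine hdec 2 Y fun t => ?_
      have e1 := hYt t
      simp only [Fin.sum_univ_three, hY1, hY0, Matrix.mulVec_zero, Pi.zero_apply,
        mul_zero, zero_add] at e1 ⊢
      rw [(mul_eq_zero.1 e1).resolve_left (h21 t), mul_zero]
    have hY1' : Y' 1 = 0 := by
      refine hdec 1 Y' fun t => ?_
      have e1 := hYt' t
      simp only [Fin.sum_univ_three, ← h0, hY2', hY0, Matrix.mulVec_zero, Pi.zero_apply,
        mul_zero, zero_add, add_zero] at e1 ⊢
      rw [(mul_eq_zero.1 e1).resolve_left (h12 t), mul_zero]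
    have e1 : Y = 0 := by
      ext j : 1
      fin_cases j <;> assumption
    have e2 : Y' = 0 := by
      ext j : 1
      fin_cases j
      · exact h0.symm.trans hY0
      · exact hY1'
      · exact hY2'
    subst e1 e2
    rfl
  have h := LinearMap.finrank_le_finrank_of_injective hD
  rw [Module.finrank_prod, Module.finrank_fin_fun] at h
  have := hker 1
  have := hker 2
  omega

end OuterBound

namespace SISOScenario

variable {V E : Type*} [Fintype E] (S : SISOScenario V E)

theorem eval_transfer_eq_aeval_slotCopy {N q m : ℕ} (ξ : S.SchemeVar N q → GaloisField 2 m)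
    (t : Fin N) (j i : Fin 3) :
    MvPolynomial.eval (fun v => ξ (Sum.inl (t, v))) (S.transfer (GaloisField 2 m) j i) =
      MvPolynomial.aeval ξ (slotCopy N q t (S.transfer (ZMod 2) j i)) := by
  rw [transfer, ← S.map_pathSum (algebraMap (ZMod 2) (GaloisField 2 m)), MvPolynomial.eval_map]
  symm
  exact (MvPolynomial.aeval_rename _ _ _).trans (MvPolynomial.aeval_def _ _)

variable {S}

theorem CrossRelation.map {R R' : Type*} [CommRing R] [CommRing R'] {m : Fin 3 → Fin 3 → R}
    (h : CrossRelation m) (f : R →+* R') : CrossRelation fun j i => f (m j i) := by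
  have h' := congrArg f h
  simpa only [CrossRelation, map_add, map_mul] using h'

end SISOScenario

namespace PrecodingScheme

open SISOScenario

variable {V E : Type*} [Fintype E] (S : SISOScenario V E)

theorem received_eq {lam : PrecodingScheme S.toNetwork} {m : ℕ}
    (ξ : S.SchemeVar lam.N lam.q → GaloisField 2 m)
    (X : (j : Fin 3) → Fin (lam.k j) → GaloisField 2 m) (i : Fin 3) (t : Fin lam.N) :
    received S lam m ξ X i t =
      ∑ j, MvPolynomial.aeval ξ (slotCopy lam.N lam.q t (S.transfer (ZMod 2) j i)) *
        ((lam.V m j).map (evalAt ξ) *ᵥ X j) t := by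
  simp only [received, eval_transfer_eq_aeval_slotCopy]

theorem successProb_le_one (lam : PrecodingScheme S.toNetwork) (m : ℕ) :
    successProb S lam m ≤ 1 :=
  div_le_one_of_le₀ (Nat.cast_le.2 (Nat.card_le_card_of_injective _ Subtype.val_injective))
    (Nat.cast_nonneg _)

theorem two_mul_sum_le_of_tendsto (hconn : S.FullyConnected)
    (hrel : CrossRelation (S.transfer (ZMod 2))) (lam : PrecodingScheme S.toNetwork)
    (h : Tendsto (fun m => successProb S lam m) atTop (𝓝 1)) :
    2 * (lam.k 0 + lam.k 1 + lam.k 2) ≤ lam.k 0 + 2 * lam.N := by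
  have hne : ∀ j i t, slotCopy lam.N lam.q t (S.transfer (ZMod 2) j i) ≠ 0 := fun j i t =>
    slotCopy_ne_zero (S.pathSum_ne_zero _ (reaches_of_fullyConnected hconn j i)) t
  obtain ⟨m, ξ, ⟨-, hD⟩, hF⟩ := exists_aeval_ne_zero_of_tendsto
    (F := ∏ t, slotCopy lam.N lam.q t (S.transfer (ZMod 2) 1 2) *
      slotCopy lam.N lam.q t (S.transfer (ZMod 2) 2 1))
    (Finset.prod_ne_zero_iff.2 fun t _ => mul_ne_zero (hne _ _ _) (hne _ _ _)) h
  rw [map_prod, Finset.prod_ne_zero_iff] at hF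
  have hF' := fun t => mul_ne_zero_iff.1 ((map_mul (MvPolynomial.aeval ξ) _ _).subst
    (motive := fun x => x ≠ 0) (hF t (Finset.mem_univ t)))
  refine two_mul_sum_le_of_decodable (K := GaloisField 2 m)
    (μ := fun t j i => MvPolynomial.aeval ξ (slotCopy lam.N lam.q t (S.transfer (ZMod 2) j i)))
    (W := fun j => (lam.V m j).map (evalAt ξ)) (fun t => ?_) (fun t => (hF' t).1)
    (fun t => (hF' t).2) fun i X hX => ?_
  · exact hrel.map ((MvPolynomial.aeval (R := ZMod 2) ξ).toRingHom.comp
      (slotCopy lam.N lam.q t))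
  · obtain ⟨D, hD⟩ := hD i
    have h1 : received S lam m ξ X i = received S lam m ξ 0 i := by
      ext t
      rw [received_eq, received_eq, hX]
      simp
    rw [← hD X, h1, hD]
    rfl

/-- The rates that some scheme achieves simultaneously for all three sessions. -/
def SymmetricRates : Set ℚ :=
  {R : ℚ | ∃ lam : PrecodingScheme S.toNetwork, Achieves S lam fun _ => R}

theorem le_of_mem_symmetricRates (hconn : S.FullyConnected)
    (hrel : CrossRelation (S.transfer (ZMod 2))) {R : ℚ} (hR : R ∈ SymmetricRates S) :
    R ≤ 2 / 5 := by
  obtain ⟨lam, hk, h⟩ := hR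
  have h1 := two_mul_sum_le_of_tendsto S hconn hrel lam h
  have hN : (0 : ℚ) < lam.N := by exact_mod_cast lam.N_pos
  have hk' : ∀ i, (lam.k i : ℚ) = R * lam.N := fun i => by
    rw [show R = lam.k i / lam.N from hk i, div_mul_cancel₀ _ hN.ne']
  have h2 : (2 * (lam.k 0 + lam.k 1 + lam.k 2) : ℚ) ≤ lam.k 0 + 2 * lam.N := by
    exact_mod_cast h1
  rw [hk', hk', hk'] at h2
  refine le_of_mul_le_mul_right ?_ hN
  linarith

variable {S} in
/-- The same scheme after the sessions have been renumbered by `π`. -/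
def relabel (lam : PrecodingScheme S.toNetwork) (π : Equiv.Perm (Fin 3)) :
    PrecodingScheme (S.relabel π).toNetwork where
  N := lam.N
  N_pos := lam.N_pos
  k := fun i => lam.k (π i)
  k_le := fun i => lam.k_le (π i)
  q := lam.q
  V := fun m i => lam.V m (π i)

theorem Success.relabel {lam : PrecodingScheme S.toNetwork} {m : ℕ}
    {ξ : S.SchemeVar lam.N lam.q → GaloisField 2 m} (h : Success S lam m ξ)
    (π : Equiv.Perm (Fin 3)) : Success (S.relabel π) (lam.relabel π) m ξ := by
  refine ⟨fun i => h.1 (π i), fun i => ?_⟩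
  obtain ⟨D, hD⟩ := h.2 (π i)
  refine ⟨D, fun X => ?_⟩
  let X' : (j : Fin 3) → Fin (lam.k j) → GaloisField 2 m :=
    Equiv.piCongrLeft (fun j => Fin (lam.k j) → GaloisField 2 m) π X
  have hX' : ∀ j, X' (π j) = X j := fun j =>
    Equiv.piCongrLeft_apply_apply (fun j => Fin (lam.k j) → GaloisField 2 m) π X j
  refine Eq.trans (congrArg D ?_) ((hD X').trans (hX' i))
  ext t
  refine Eq.trans ?_ (Equiv.sum_comp π _)
  refine Finset.sum_congr rfl fun j _ => ?_
  rw [hX']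
  rfl

theorem symmetricRates_subset_relabel (π : Equiv.Perm (Fin 3)) :
    SymmetricRates S ⊆ SymmetricRates (S.relabel π) := by
  rintro R ⟨lam, hk, h⟩
  refine ⟨lam.relabel π, fun i => hk (π i), ?_⟩
  refine tendsto_of_tendsto_of_tendsto_of_le_of_le h tendsto_const_nhds (fun m => ?_) fun m => ?_
  · refine div_le_div_of_nonneg_right (Nat.cast_le.2 ?_) (Nat.cast_nonneg _)
    have : Finite {ξ : S.SchemeVar lam.N lam.q → GaloisField 2 m //
        Success (S.relabel π) (lam.relabel π) m ξ} :=
      @Subtype.finite _ (inferInstanceAs (Finite (S.SchemeVar lam.N lam.q → GaloisField 2 m))) _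
    exact @Nat.card_le_card_of_injective _ _ this
      (Subtype.map id fun ξ (hξ : Success S lam m ξ) => hξ.relabel S π)
      (Subtype.map_injective _ Function.injective_id)
  · exact successProb_le_one _ _ m

omit [Fintype E] in
theorem relabel_relabel_inv (π : Equiv.Perm (Fin 3)) : (S.relabel π).relabel π⁻¹ = S := by
  cases S
  simp [SISOScenario.relabel, Function.comp_assoc]

theorem symmetricRates_relabel (π : Equiv.Perm (Fin 3)) :
    SymmetricRates (S.relabel π) = SymmetricRates S := by
  refine Set.Subset.antisymm ?_ (symmetricRates_subset_relabel S π)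
  have h := symmetricRates_subset_relabel (S.relabel π) π⁻¹
  rwa [relabel_relabel_inv] at h

end PrecodingScheme

/-! ### Decoding with the Cadambe–Jafar precoders -/

section SlotValues

/-- The numerator `m₁₃ m₂₁ m₃₂` of `η`. -/
def etaNum {B : Type*} [CommRing B] (μ : Fin 3 → Fin 3 → B) : B := μ 0 2 * μ 1 0 * μ 2 1

/-- The denominator `m₁₂ m₂₃ m₃₁` of `η`. -/
def etaDen {B : Type*} [CommRing B] (μ : Fin 3 → Fin 3 → B) : B := μ 0 1 * μ 1 2 * μ 2 0

theorem map_etaNum {B B' : Type*} [CommRing B] [CommRing B'] (f : B →+* B')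
    (μ : Fin 3 → Fin 3 → B) : f (etaNum μ) = etaNum fun j i => f (μ j i) := by
  simp [etaNum]

theorem map_etaDen {B B' : Type*} [CommRing B] [CommRing B'] (f : B →+* B')
    (μ : Fin 3 → Fin 3 → B) : f (etaDen μ) = etaDen fun j i => f (μ j i) := by
  simp [etaDen]

/-- The numerators of the entries of the Cadambe–Jafar precoding matrices, by session and column,
in terms of the transfer functions of a time slot. -/
def cjNum {B : Type*} [CommRing B] (μ : Fin 3 → Fin 3 → B) : Fin 3 → ℕ → B
  | 0, c => etaNum μ ^ c
  | 1, c => μ 0 2 * etaNum μ ^ c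
  | 2, c => μ 0 1 * etaNum μ ^ (c + 1)

/-- The denominators of the entries of the Cadambe–Jafar precoding matrices. -/
def cjDen {B : Type*} [CommRing B] (μ : Fin 3 → Fin 3 → B) : Fin 3 → ℕ → B
  | 0, c => etaDen μ ^ c
  | 1, c => μ 1 2 * etaDen μ ^ c
  | 2, c => μ 2 1 * etaDen μ ^ (c + 1)

theorem map_cjNum {B B' : Type*} [CommRing B] [CommRing B'] (f : B →+* B')
    (μ : Fin 3 → Fin 3 → B) (i : Fin 3) (c : ℕ) :
    f (cjNum μ i c) = cjNum (fun j i => f (μ j i)) i c := by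
  fin_cases i <;> simp [cjNum, map_etaNum]

theorem map_cjDen {B B' : Type*} [CommRing B] [CommRing B'] (f : B →+* B')
    (μ : Fin 3 → Fin 3 → B) (i : Fin 3) (c : ℕ) :
    f (cjDen μ i c) = cjDen (fun j i => f (μ j i)) i c := by
  fin_cases i <;> simp [cjDen, map_etaDen]

variable {K : Type*} [Field K]

theorem etaDen_ne_zero {μ : Fin 3 → Fin 3 → K} (hμ : ∀ j i, μ j i ≠ 0) : etaDen μ ≠ 0 :=
  mul_ne_zero (mul_ne_zero (hμ _ _) (hμ _ _)) (hμ _ _)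

theorem etaNum_ne_zero {μ : Fin 3 → Fin 3 → K} (hμ : ∀ j i, μ j i ≠ 0) : etaNum μ ≠ 0 :=
  mul_ne_zero (mul_ne_zero (hμ _ _) (hμ _ _)) (hμ _ _)

theorem cjDen_ne_zero {μ : Fin 3 → Fin 3 → K} (hμ : ∀ j i, μ j i ≠ 0) (i : Fin 3) (c : ℕ) :
    cjDen μ i c ≠ 0 := by
  have := etaDen_ne_zero hμ
  fin_cases i
  · exact pow_ne_zero _ this
  · exact mul_ne_zero (hμ _ _) (pow_ne_zero _ this)
  · exact mul_ne_zero (hμ _ _) (pow_ne_zero _ this)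

/-- Decoding with the Cadambe–Jafar precoders for `n = 2`, when session `0` uses the columns
`1` and `η²` only. At receiver `0` the cross relation turns the received signal into a polynomial
of degree at most three in `η`, in which the symbols of session `0` are the constant and the cubic
coefficient. At the other receivers the interference lies in the span of `1, η, η²`. -/
theorem eq_zero_of_received_eq_zero {ν : Fin 5 → Fin 3 → Fin 3 → K} (hν : ∀ t j i, ν t j i ≠ 0)
    (hrel : ∀ t, SISOScenario.CrossRelation (ν t))
    (hη : Function.Injective fun t => etaNum (ν t) / etaDen (ν t))
    (h₁ : (pairingMatrix (fun t => etaNum (ν t)) (fun t => etaDen (ν t))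
      fun t => ν t 1 1 * ν t 0 2 * ν t 2 0).det ≠ 0)
    (h₂ : (pairingMatrix (fun t => etaNum (ν t)) (fun t => etaDen (ν t))
      fun t => ν t 2 2 * ν t 0 1 * ν t 1 0).det ≠ 0)
    (i : Fin 3) (X : Fin 3 → Fin 2 → K)
    (hX : ∀ t, ∑ j, ν t j i * ∑ c : Fin 2,
      cjNum (ν t) j (if j = 0 then 2 * c else c) /
        cjDen (ν t) j (if j = 0 then 2 * c else c) * X j c = 0) : X i = 0 := by
  have hq : ∀ t, etaDen (ν t) ≠ 0 := fun t => etaDen_ne_zero (hν t)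
  set x : Fin 5 → K := fun t => etaNum (ν t) / etaDen (ν t) with hx
  have hp : ∀ t, etaNum (ν t) = x t * etaDen (ν t) := fun t => (div_mul_cancel₀ _ (hq t)).symm
  set y : Fin 5 → K := fun t => ν t 0 2 / ν t 1 2
  set z : Fin 5 → K := fun t => ν t 0 1 / ν t 2 1
  have hy : ∀ t, y t * ν t 1 2 = ν t 0 2 := fun t => div_mul_cancel₀ _ (hν t _ _)
  have hz : ∀ t, z t * ν t 2 1 = ν t 0 1 := fun t => div_mul_cancel₀ _ (hν t _ _)
  have hX' : ∀ t, ν t 0 i * (X 0 0 + X 0 1 * x t ^ 2) + ν t 1 i * (y t * (X 1 0 + X 1 1 * x t)) +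
      ν t 2 i * (z t * (X 2 0 * x t + X 2 1 * x t ^ 2)) = 0 := by
    intro t
    have h := hX t
    simp only [Fin.sum_univ_three, Fin.sum_univ_two, cjNum, cjDen, mul_div_mul_comm, ← div_pow,
      Fin.val_zero, Fin.val_one, if_true, mul_zero, mul_one, pow_zero, pow_one, zero_add,
      one_ne_zero, if_false, show (2 : Fin 3) ≠ 0 by decide] at h
    linear_combination h
  have hrow : ∀ r : Fin 5 → K, (pairingMatrix (fun t => etaNum (ν t)) (fun t => etaDen (ν t))
      r).det ≠ 0 → ∀ v : Fin 5 → K, (∀ t, r t * etaDen (ν t) * v 0 + r t * etaNum (ν t) * v 1 +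
        etaDen (ν t) ^ 2 * v 2 + etaDen (ν t) * etaNum (ν t) * v 3 + etaNum (ν t) ^ 2 * v 4 = 0) →
      v = 0 := by
    intro r hr v hv
    by_contra hv0
    refine hr (Matrix.exists_mulVec_eq_zero_iff.1 ⟨v, hv0, funext fun t => ?_⟩)
    simpa [pairingMatrix, Matrix.mulVec, dotProduct, Fin.sum_univ_five] using hv t
  have hqd : ∀ t, etaDen (ν t) = ν t 0 1 * ν t 1 2 * ν t 2 0 := fun t => rfl
  have hpd : ∀ t, x t * etaDen (ν t) = ν t 0 2 * ν t 1 0 * ν t 2 1 := fun t => (hp t).symm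
  rcases (by decide : ∀ i : Fin 3, i = 0 ∨ i = 1 ∨ i = 2) i with rfl | rfl | rfl
  · have hv : (![X 0 0, X 0 0 + X 1 0 + X 2 0, X 0 1 + X 1 1 + X 2 1, X 0 1] : Fin 4 → K) = 0 := by
      refine Matrix.eq_zero_of_forall_index_sum_pow_mul_eq_zero
        (hη.comp (Fin.castLE_injective (by omega : 4 ≤ 5))) fun j => ?_
      set t : Fin 5 := Fin.castLE (by omega) j
      change ∑ i : Fin 4, x t ^ (i : ℕ) * _ = 0
      have h := hX' t
      have hr : ν t 0 1 * ν t 1 2 * ν t 2 0 + ν t 0 2 * ν t 1 0 * ν t 2 1 =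
        ν t 0 0 * ν t 1 2 * ν t 2 1 := hrel t
      rw [← hqd, ← hpd] at hr
      refine (mul_eq_zero.1 (?_ : etaDen (ν t) * _ = 0)).resolve_left (hq t)
      simp only [Fin.sum_univ_four, Fin.val_zero, Fin.val_one, Fin.val_two, cons_val,
        show ((3 : Fin 4) : ℕ) = 3 from rfl]
      linear_combination ν t 1 2 * ν t 2 1 * h + (X 0 0 + X 0 1 * x t ^ 2) * hr -
        ν t 1 0 * ν t 2 1 * (X 1 0 + X 1 1 * x t) * hy t -
        ν t 2 0 * ν t 1 2 * (X 2 0 * x t + X 2 1 * x t ^ 2) * hz t +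
        (X 1 0 + X 1 1 * x t) * hpd t +
        (X 2 0 * x t + X 2 1 * x t ^ 2) * hqd t
    ext c
    fin_cases c
    · exact congrFun hv 0
    · exact congrFun hv 3
  · have hv := hrow _ h₁ ![X 1 0, X 1 1, X 0 0, X 2 0, X 0 1 + X 2 1] fun t => by
      simp only [cons_val, hp]
      linear_combination (etaDen (ν t) * ν t 1 2 * ν t 2 0) * hX' t -
        etaDen (ν t) * ν t 1 1 * ν t 2 0 * (X 1 0 + X 1 1 * x t) * hy t -
        etaDen (ν t) * ν t 1 2 * ν t 2 0 * (X 2 0 * x t + X 2 1 * x t ^ 2) * hz t +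
        etaDen (ν t) * (X 0 0 + X 0 1 * x t ^ 2 + X 2 0 * x t + X 2 1 * x t ^ 2) * hqd t
    ext c
    fin_cases c
    · exact congrFun hv 0
    · exact congrFun hv 1
  · have hv := hrow _ h₂ ![X 2 0, X 2 1, X 0 0 + X 1 0, X 1 1, X 0 1] fun t => by
      have hxz : x t * z t * (ν t 1 2 * ν t 2 0) = ν t 0 2 * ν t 1 0 := by
        refine mul_right_cancel₀ (hν t 2 1) ?_
        rw [← hpd, hqd]
        linear_combination x t * ν t 1 2 * ν t 2 0 * hz t
      refine (mul_eq_zero.1 (?_ : ν t 0 2 * _ = 0)).resolve_left (hν t 0 2)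
      simp only [cons_val, hp]
      linear_combination (etaDen (ν t) * (ν t 0 1 * ν t 1 2 * ν t 2 0)) * hX' t -
        etaDen (ν t) * (ν t 0 1 * ν t 1 2 * ν t 2 0) * (X 1 0 + X 1 1 * x t) * hy t -
        etaDen (ν t) * ν t 0 1 * ν t 2 2 * (X 2 0 + X 2 1 * x t) * hxz +
        etaDen (ν t) * ν t 0 2 * (X 0 0 + X 0 1 * x t ^ 2 + X 1 0 + X 1 1 * x t) * hqd t
    ext c
    fin_cases c
    · exact congrFun hv 0
    · exact congrFun hv 1

theorem rank_eq_of_scaled_vandermonde {N k : ℕ} (hk : k ≤ N) {A : Matrix (Fin N) (Fin k) K}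
    {d x : Fin N → K} (hd : ∀ t, d t ≠ 0) (hx : Function.Injective x)
    (hA : ∀ t c, A t c = d t * x t ^ (c : ℕ)) : A.rank = k := by
  have h : LinearIndependent K A.col := by
    rw [← Matrix.mulVec_injective_iff]
    refine (injective_iff_map_eq_zero A.mulVecLin).2 fun v hv => ?_
    refine Matrix.eq_zero_of_forall_index_sum_pow_mul_eq_zero
      (hx.comp (Fin.castLE_injective hk)) fun j => ?_
    have h1 := congrFun hv (Fin.castLE hk j)
    simp only [Matrix.mulVecLin_apply, Matrix.mulVec, dotProduct, hA, mul_assoc,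
      ← Finset.mul_sum, Pi.zero_apply] at h1
    exact (mul_eq_zero.1 h1).resolve_left (hd _)
  rw [← Matrix.rank_transpose]
  simpa using LinearIndependent.rank_matrix (M := Aᵀ) h

theorem colSpan_le_of_forall_col {ι κ κ' : Type*} {A : Matrix ι κ K} {B : Matrix ι κ' K}
    (h : ∀ c, ∃ c', ∀ t, A t c = B t c') :
    PrecodingScheme.colSpan A ≤ PrecodingScheme.colSpan B := by
  refine Submodule.span_mono ?_
  rintro _ ⟨c, rfl⟩
  obtain ⟨c', hc'⟩ := h c
  exact ⟨c', funext fun t => (hc' t).symm⟩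

end SlotValues

/-! ### The Cadambe–Jafar scheme of a network -/

theorem Matrix.inv_diagonal_of_ne_zero {n K : Type*} [Fintype n] [DecidableEq n] [Field K]
    {v : n → K} (hv : ∀ i, v i ≠ 0) :
    (Matrix.diagonal v)⁻¹ = Matrix.diagonal fun i => (v i)⁻¹ := by
  refine Matrix.inv_eq_right_inv ?_
  rw [Matrix.diagonal_mul_diagonal, ← Matrix.diagonal_one]
  congr 1
  ext i
  exact mul_inv_cancel₀ (hv i)

namespace SISOScenario

variable {V E : Type*} [Fintype E] (S : SISOScenario V E)

theorem etaNum_transfer_ne {S : SISOScenario V E} (hconn : S.FullyConnected)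
    (hrel : CrossRelation (S.transfer (ZMod 2))) :
    etaNum (S.transfer (ZMod 2)) ≠ etaDen (S.transfer (ZMod 2)) := by
  have hne : ∀ j i, S.transfer (ZMod 2) j i ≠ 0 := fun j i =>
    S.pathSum_ne_zero _ (reaches_of_fullyConnected hconn j i)
  intro h
  have h' : etaDen (S.transfer (ZMod 2)) + etaNum (S.transfer (ZMod 2)) = _ := hrel
  rw [h, CharTwo.add_self_eq_zero] at h'
  exact mul_ne_zero (mul_ne_zero (hne 0 0) (hne 1 2)) (hne 2 1) h'.symm

/-- The transfer function from `σ j` to `τ i` in the time slot `t`, as a rational function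
in `ξ`. -/
noncomputable def slotTransfer (N q m : ℕ) (t : Fin N) (j i : Fin 3) : S.SchemeField N q m :=
  algebraMap (MvPolynomial (S.SchemeVar N q) (GaloisField 2 m)) _
    (MvPolynomial.rename (fun v => Sum.inl (t, v)) (S.transfer (GaloisField 2 m) j i))

/-- The inclusion of the polynomials in `ξ` over `𝔽₂` into the field of rational functions over
the field with `2 ^ m` elements. -/
noncomputable def schemeHom (N q m : ℕ) :
    MvPolynomial (S.SchemeVar N q) (ZMod 2) →+* S.SchemeField N q m :=
  (algebraMap (MvPolynomial (S.SchemeVar N q) (GaloisField 2 m)) (S.SchemeField N q m)).comp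
    (MvPolynomial.map (algebraMap (ZMod 2) (GaloisField 2 m)))

omit [Fintype E] in
theorem schemeHom_injective (N q m : ℕ) : Function.Injective (S.schemeHom N q m) :=
  (IsFractionRing.injective _ _).comp
    (MvPolynomial.map_injective _ (algebraMap (ZMod 2) (GaloisField 2 m)).injective)

theorem slotTransfer_eq (N q m : ℕ) (t : Fin N) (j i : Fin 3) :
    S.slotTransfer N q m t j i =
      S.schemeHom N q m (slotCopy N q t (S.transfer (ZMod 2) j i)) := by
  rw [slotTransfer, transfer, ← S.map_pathSum (algebraMap (ZMod 2) (GaloisField 2 m))]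
  exact congrArg _ (MvPolynomial.map_rename _ _ _).symm

variable {S} (hconn : S.FullyConnected)
include hconn

theorem slotTransfer_ne_zero (N q m : ℕ) (t : Fin N) (j i : Fin 3) :
    S.slotTransfer N q m t j i ≠ 0 := by
  rw [slotTransfer_eq]
  exact (map_ne_zero_iff _ (S.schemeHom_injective N q m)).2
    (slotCopy_ne_zero (S.pathSum_ne_zero _ (reaches_of_fullyConnected hconn j i)) t)

theorem slotTransfer_eta_injective (hrel : CrossRelation (S.transfer (ZMod 2))) (N q m : ℕ) :
    Function.Injective fun t =>
      etaNum (S.slotTransfer N q m t) / etaDen (S.slotTransfer N q m t) := by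
  intro s t hst
  have hne := slotTransfer_ne_zero hconn N q m
  have h := (div_eq_div_iff (etaDen_ne_zero (hne s)) (etaDen_ne_zero (hne t))).1 hst
  have h0 : ∀ j i, S.transfer (ZMod 2) j i ≠ 0 := fun j i =>
    S.pathSum_ne_zero _ (reaches_of_fullyConnected hconn j i)
  have e1 : ∀ t, etaNum (S.slotTransfer N q m t) =
      S.schemeHom N q m (slotCopy N q t (etaNum (S.transfer (ZMod 2)))) := fun t => by
    rw [map_etaNum, map_etaNum]
    simp only [etaNum, slotTransfer_eq]
  have e2 : ∀ t, etaDen (S.slotTransfer N q m t) =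
      S.schemeHom N q m (slotCopy N q t (etaDen (S.transfer (ZMod 2)))) := fun t => by
    rw [map_etaDen, map_etaDen]
    simp only [etaDen, slotTransfer_eq]
  rw [e1, e2, e1, e2, ← map_mul, ← map_mul] at h
  by_contra hne'
  exact slotCopy_mul_ne (mul_ne_zero (mul_ne_zero (h0 _ _) (h0 _ _)) (h0 _ _))
    (mul_ne_zero (mul_ne_zero (h0 _ _) (h0 _ _)) (h0 _ _)) (etaNum_transfer_ne hconn hrel) hne'
    (S.schemeHom_injective N q m h)

end SISOScenario

namespace PrecodingScheme

open SISOScenario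

variable {V E : Type*} [Fintype E] {S : SISOScenario V E}

theorem cjCol_eq (hconn : S.FullyConnected) (n m : ℕ) (i : Fin 3) (c : ℕ)
    (t : Fin (2 * n + 1)) :
    cjCol S n m i c t = cjNum (S.slotTransfer (2 * n + 1) 0 m t) i c /
      cjDen (S.slotTransfer (2 * n + 1) 0 m t) i c := by
  have hM : ∀ j i, S.M (2 * n + 1) 0 m j i =
      Matrix.diagonal fun t => S.slotTransfer (2 * n + 1) 0 m t j i := fun _ _ => rfl
  have hMi : ∀ j i, (S.M (2 * n + 1) 0 m j i)⁻¹ =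
      Matrix.diagonal fun t => (S.slotTransfer (2 * n + 1) 0 m t j i)⁻¹ := fun j i =>
    Matrix.inv_diagonal_of_ne_zero fun t => slotTransfer_ne_zero hconn _ _ _ t j i
  have hT : cjT S n m = Matrix.diagonal fun t =>
      etaNum (S.slotTransfer (2 * n + 1) 0 m t) / etaDen (S.slotTransfer (2 * n + 1) 0 m t) := by
    rw [cjT, hMi, hMi, hMi, hM, hM, hM]
    simp only [Matrix.diagonal_mul_diagonal]
    congr 1
    ext t
    simp only [etaNum, etaDen, div_eq_mul_inv, mul_inv]
    ring
  rcases (by decide : ∀ i : Fin 3, i = 0 ∨ i = 1 ∨ i = 2) i with rfl | rfl | rfl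
  · rw [cjCol, hT, Matrix.diagonal_pow, Matrix.mulVec_diagonal]
    simp [cjNum, cjDen, div_pow]
  · rw [cjCol, hT, hMi, hM, Matrix.diagonal_pow, Matrix.diagonal_mul_diagonal,
      Matrix.diagonal_mul_diagonal, Matrix.mulVec_diagonal]
    simp only [cjNum, cjDen, mul_div_mul_comm, div_pow, ← div_eq_mul_inv, Pi.one_apply, Pi.pow_apply,
      mul_one]
  · rw [cjCol, hT, hMi, hM, Matrix.diagonal_pow, Matrix.diagonal_mul_diagonal,
      Matrix.diagonal_mul_diagonal, Matrix.mulVec_diagonal]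
    simp only [cjNum, cjDen, mul_div_mul_comm, div_pow, ← div_eq_mul_inv, Pi.one_apply, Pi.pow_apply,
      mul_one]

theorem isPBNA_cadambeJafar (hconn : S.FullyConnected)
    (hrel : CrossRelation (S.transfer (ZMod 2))) {n : ℕ} (hn : 0 < n) :
    IsPBNA S (cadambeJafar S n) n 1 := by
  refine ⟨hn, Or.inr rfl, rfl, rfl, rfl, rfl, fun m _ => ?_⟩
  have hne := slotTransfer_ne_zero hconn (2 * n + 1) 0 m
  have hinj := slotTransfer_eta_injective hconn hrel (2 * n + 1) 0 m
  have hP := fun t => etaNum_ne_zero (hne t)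
  have hQ := fun t => etaDen_ne_zero (hne t)
  set μ := S.slotTransfer (2 * n + 1) 0 m with hμ
  let W (i : Fin 3) (k : ℕ) : Matrix (Fin (2 * n + 1)) (Fin k) (S.SchemeField (2 * n + 1) 0 m) :=
    Matrix.of fun t c => cjCol S n m i c t
  have hW : ∀ i k t c, W i k t c = cjNum (μ t) i c / cjDen (μ t) i c :=
    fun i k t c => cjCol_eq hconn n m i c t
  have hMW : ∀ j i k t c, (S.M (2 * n + 1) 0 m j i * W j k) t c =
      μ t j i * (cjNum (μ t) j c / cjDen (μ t) j c) := fun j i k t c => by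
    rw [← hW]
    exact Matrix.diagonal_mul _ _ _ _
  -- `T` maps the columns that session `1` shows at receiver `0` to those of session `2`.
  have h10 : ∀ t c, μ t 1 0 * (cjNum (μ t) 1 c / cjDen (μ t) 1 c) =
      μ t 2 0 * (cjNum (μ t) 2 c / cjDen (μ t) 2 c) := by
    intro t c
    have h0 := hne t 0 1
    have h1 := hne t 1 2
    have h2 := hne t 2 1
    have h3 := hne t 2 0
    simp only [cjNum, cjDen, etaNum, etaDen]
    field_simp
    ring
  have key : (W 0 (n + 1)).rank = n + 1 ∧ (W 1 n).rank = n ∧ (W 2 n).rank = n ∧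
      colSpan (S.M (2 * n + 1) 0 m 1 0 * W 1 n) = colSpan (S.M (2 * n + 1) 0 m 2 0 * W 2 n) ∧
      colSpan (S.M (2 * n + 1) 0 m 2 1 * W 2 n) ≤
        colSpan (S.M (2 * n + 1) 0 m 0 1 * W 0 (n + 1)) ∧
      colSpan (S.M (2 * n + 1) 0 m 1 2 * W 1 n) ≤
        colSpan (S.M (2 * n + 1) 0 m 0 2 * W 0 (n + 1)) := by
    refine ⟨?_, ?_, ?_, le_antisymm ?_ ?_, ?_, ?_⟩
    · refine rank_eq_of_scaled_vandermonde (by omega) (d := fun _ => 1) (fun _ => one_ne_zero)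
        hinj fun t c => ?_
      rw [one_mul, div_pow]
      exact hW 0 _ t c
    · refine rank_eq_of_scaled_vandermonde (by omega) (d := fun t => μ t 0 2 / μ t 1 2)
        (fun t => div_ne_zero (hne _ _ _) (hne _ _ _)) hinj fun t c => ?_
      rw [div_pow, ← mul_div_mul_comm]
      exact hW 1 _ t c
    · refine rank_eq_of_scaled_vandermonde (by omega)
        (d := fun t => μ t 0 1 / μ t 2 1 * (etaNum (μ t) / etaDen (μ t)))
        (fun t => mul_ne_zero (div_ne_zero (hne _ _ _) (hne _ _ _)) (div_ne_zero (hP t) (hQ t)))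
        hinj fun t c => ?_
      rw [mul_assoc, ← pow_succ', div_pow, ← mul_div_mul_comm]
      exact hW 2 _ t c
    · exact colSpan_le_of_forall_col fun c => ⟨c, fun t => by rw [hMW, hMW, h10]⟩
    · exact colSpan_le_of_forall_col fun c => ⟨c, fun t => by rw [hMW, hMW, h10]⟩
    · refine colSpan_le_of_forall_col fun c => ⟨c.succ, fun t => ?_⟩
      rw [hMW, hMW]
      simp only [cjNum, cjDen, Fin.val_succ]
      rw [mul_div_mul_comm, ← mul_assoc, mul_div_cancel₀ _ (hne t 2 1)]
    · refine colSpan_le_of_forall_col fun c => ⟨c.castSucc, fun t => ?_⟩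
      rw [hMW, hMW]
      simp only [cjNum, cjDen, Fin.val_castSucc]
      rw [mul_div_mul_comm, ← mul_assoc, mul_div_cancel₀ _ (hne t 1 2)]
  exact key

theorem exists_decoder {lam : PrecodingScheme S.toNetwork} {m : ℕ}
    {ξ : S.SchemeVar lam.N lam.q → GaloisField 2 m} {i : Fin 3}
    (h : ∀ X : (j : Fin 3) → Fin (lam.k j) → GaloisField 2 m,
      (∀ t, ∑ j, MvPolynomial.aeval ξ (slotCopy lam.N lam.q t (S.transfer (ZMod 2) j i)) *
        ∑ c, evalAt ξ (lam.V m j t c) * X j c = 0) → X i = 0) :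
    ∃ D : (Fin lam.N → GaloisField 2 m) → (Fin (lam.k i) → GaloisField 2 m),
      ∀ X, D (received S lam m ξ X i) = X i := by
  have hsub : ∀ X X', received S lam m ξ (X - X') i =
      received S lam m ξ X i - received S lam m ξ X' i := fun X X' => by
    ext t
    simp [received, Matrix.mulVec_sub, mul_sub, Finset.sum_sub_distrib]
  refine ⟨fun y => Function.invFun (fun X => received S lam m ξ X i) y i, fun X => ?_⟩
  set X' := Function.invFun (fun X => received S lam m ξ X i) (received S lam m ξ X i)
  have hX' : received S lam m ξ X' i = received S lam m ξ X i :=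
    Function.invFun_eq (f := fun X => received S lam m ξ X i) ⟨X, rfl⟩
  refine sub_eq_zero.1 (h (X' - X) fun t => ?_)
  have ht := congrFun ((hsub X' X).trans (sub_eq_zero.2 hX')) t
  rw [received_eq] at ht
  exact ht

/-- The selection of the columns of the Cadambe–Jafar precoders for `n = 2`: session `0` leaves
out the middle one of its three columns. -/
def cjSelection (S : SISOScenario V E) (i : Fin 3) :
    Fin 2 ↪ Fin ((cadambeJafar S 2).k i) where
  toFun c := ⟨if i = 0 then 2 * c else c, by
    have := c.isLt
    simp only [cadambeJafar]
    split_ifs <;> omega⟩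
  inj' c c' h := by
    have h' := congrArg Fin.val h
    simp only at h'
    ext
    split_ifs at h' <;> omega

/-- At a point where no transfer function vanishes, where `η` separates the time slots, and where
the matrices of the receivers `1` and `2` are nonsingular, all receivers decode. -/
theorem success_cadambeJafar (hconn : S.FullyConnected)
    (hrel : CrossRelation (S.transfer (ZMod 2))) {m : ℕ}
    {ξ : S.SchemeVar (2 * 2 + 1) 0 → GaloisField 2 m} {ν : Fin 5 → Fin 3 → Fin 3 → GaloisField 2 m}
    (hνξ : ∀ t j i, ν t j i =
      MvPolynomial.aeval ξ (slotCopy (2 * 2 + 1) 0 t (S.transfer (ZMod 2) j i)))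
    (hν : ∀ t j i, ν t j i ≠ 0)
    (hη : Function.Injective fun t => etaNum (ν t) / etaDen (ν t))
    (h₁ : (pairingMatrix (fun t => etaNum (ν t)) (fun t => etaDen (ν t))
      fun t => ν t 1 1 * ν t 0 2 * ν t 2 0).det ≠ 0)
    (h₂ : (pairingMatrix (fun t => etaNum (ν t)) (fun t => etaDen (ν t))
      fun t => ν t 2 2 * ν t 0 1 * ν t 1 0).det ≠ 0) :
    Success S ((cadambeJafar S 2).select (fun _ => 2) (cjSelection S)) m ξ := by
  have hrelν : ∀ t, CrossRelation (ν t) := fun t => by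
    have h := hrel.map ((MvPolynomial.aeval (R := ZMod 2) ξ).toRingHom.comp
      (slotCopy (2 * 2 + 1) 0 t))
    rw [show ν t = _ from funext fun j => funext fun i => hνξ t j i]
    exact h
  -- The entries of the precoding matrices are defined at `ξ` and have the expected values.
  have heval : ∀ t i c, DefinedAt ξ (cjCol S 2 m i c t) ∧
      evalAt ξ (cjCol S 2 m i c t) = cjNum (ν t) i c / cjDen (ν t) i c := by
    intro t i c
    let ρ (j i : Fin 3) : MvPolynomial (S.SchemeVar (2 * 2 + 1) 0) (GaloisField 2 m) :=
      MvPolynomial.rename (fun v => Sum.inl (t, v)) (S.transfer (GaloisField 2 m) j i)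
    have hρ : ∀ j i, MvPolynomial.eval ξ (ρ j i) = ν t j i := fun j i =>
      (MvPolynomial.eval_rename _ _ _).trans
        ((S.eval_transfer_eq_aeval_slotCopy ξ t j i).trans (hνξ t j i).symm)
    have e1 : MvPolynomial.eval ξ (cjNum ρ i c) = cjNum (ν t) i c := by
      rw [map_cjNum]
      simp only [hρ]
    have e2 : MvPolynomial.eval ξ (cjDen ρ i c) = cjDen (ν t) i c := by
      rw [map_cjDen]
      simp only [hρ]
    rw [← e1, ← e2]
    refine definedAt_and_evalAt_div ξ ?_ ?_
    · rw [e2]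
      exact cjDen_ne_zero (hν t) i c
    · rw [map_cjNum, map_cjDen]
      exact cjCol_eq hconn 2 m i c t
  refine ⟨fun i t c => (heval t i _).1, fun i => exists_decoder fun X hX => ?_⟩
  refine eq_zero_of_received_eq_zero hν hrelν hη h₁ h₂ i X fun t => ?_
  refine Eq.trans (Finset.sum_congr rfl fun j _ => ?_) (hX t)
  refine congrArg₂ _ (hνξ t j i) (Finset.sum_congr rfl fun c _ => ?_)
  exact congrArg (· * X j c) (heval t j (if j = 0 then 2 * c else c)).2.symm

theorem achieves_cadambeJafar (hconn : S.FullyConnected)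
    (hrel : CrossRelation (S.transfer (ZMod 2)))
    (h1 : S.transfer (ZMod 2) 0 2 * S.transfer (ZMod 2) 1 0 ≠
      S.transfer (ZMod 2) 0 0 * S.transfer (ZMod 2) 1 2)
    (h2 : S.transfer (ZMod 2) 0 1 * S.transfer (ZMod 2) 2 0 ≠
      S.transfer (ZMod 2) 0 0 * S.transfer (ZMod 2) 2 1) :
    Achieves S ((cadambeJafar S 2).select (fun _ => 2) (cjSelection S)) fun _ => 2 / 5 := by
  refine ⟨fun i => by simp [select, cadambeJafar], ?_⟩
  set μ := S.transfer (ZMod 2) with hμ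
  let s (t : Fin 5) : MvPolynomial S.CodingVar (ZMod 2) →+*
    MvPolynomial (S.SchemeVar (2 * 2 + 1) 0) (ZMod 2) := slotCopy (2 * 2 + 1) 0 t
  have h0 : ∀ j i, μ j i ≠ 0 := fun j i =>
    S.pathSum_ne_zero _ (reaches_of_fullyConnected hconn j i)
  have hP : etaNum μ ≠ 0 := mul_ne_zero (mul_ne_zero (h0 _ _) (h0 _ _)) (h0 _ _)
  have hQ : etaDen μ ≠ 0 := mul_ne_zero (mul_ne_zero (h0 _ _) (h0 _ _)) (h0 _ _)
  have hPQ := etaNum_transfer_ne hconn hrel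
  let D (r : MvPolynomial S.CodingVar (ZMod 2)) :
      MvPolynomial (S.SchemeVar (2 * 2 + 1) 0) (ZMod 2) :=
    (pairingMatrix (fun t => s t (etaNum μ)) (fun t => s t (etaDen μ)) fun t => s t r).det
  have hdet1 : D (μ 1 1 * μ 0 2 * μ 2 0) ≠ 0 := by
    obtain ⟨ψ, hψ, c, u, hu, hc⟩ := hasFreeVariable_one hconn hrel h1 h2
    refine det_pairingMatrix_slotCopy_ne_zero hP hQ hPQ (ψ := ψ) ?_ ?_
      (mul_ne_zero hu (mul_ne_zero (h0 0 2) (h0 2 0))) (c := c * (μ 0 2 * μ 2 0)) ?_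
    · simp only [etaNum, map_mul, μ]
      rw [hψ _ _ (by decide), hψ _ _ (by decide), hψ _ _ (by decide)]
    · simp only [etaDen, map_mul, μ]
      rw [hψ _ _ (by decide), hψ _ _ (by decide), hψ _ _ (by decide)]
    · simp only [map_mul, μ]
      rw [hψ 0 2 (by decide), hψ 2 0 (by decide), hc]
      ring
  have hdet2 : D (μ 2 2 * μ 0 1 * μ 1 0) ≠ 0 := by
    obtain ⟨ψ, hψ, c, u, hu, hc⟩ := hasFreeVariable_two hconn hrel h1 h2
    refine det_pairingMatrix_slotCopy_ne_zero hP hQ hPQ (ψ := ψ) ?_ ?_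
      (mul_ne_zero hu (mul_ne_zero (h0 0 1) (h0 1 0))) (c := c * (μ 0 1 * μ 1 0)) ?_
    · simp only [etaNum, map_mul, μ]
      rw [hψ _ _ (by decide), hψ _ _ (by decide), hψ _ _ (by decide)]
    · simp only [etaDen, map_mul, μ]
      rw [hψ _ _ (by decide), hψ _ _ (by decide), hψ _ _ (by decide)]
    · simp only [map_mul, μ]
      rw [hψ 0 1 (by decide), hψ 1 0 (by decide), hc]
      ring
  have hprod : (∏ t, ∏ j, ∏ i, s t (μ j i)) ≠ 0 := by
    simp only [Finset.prod_ne_zero_iff]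
    exact fun t _ j _ i _ => slotCopy_ne_zero (h0 j i) t
  have hsep : (∏ t, ∏ t', if t = t' then 1 else
      s t (etaNum μ) * s t' (etaDen μ) - s t' (etaNum μ) * s t (etaDen μ)) ≠ 0 := by
    simp only [Finset.prod_ne_zero_iff]
    intro t _ t' _
    split_ifs with h
    · exact one_ne_zero
    · exact sub_ne_zero.2 (slotCopy_mul_ne hP hQ hPQ h)
  refine tendsto_card_div_card_one
    (mul_ne_zero (mul_ne_zero (mul_ne_zero hprod hsep) hdet1) hdet2) fun m ξ _ hF => ?_
  let φ : MvPolynomial (S.SchemeVar (2 * 2 + 1) 0) (ZMod 2) →+* GaloisField 2 m :=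
    (MvPolynomial.aeval (R := ZMod 2) ξ).toRingHom
  replace hF : φ _ ≠ 0 := hF
  rw [map_mul, map_mul, map_mul, mul_ne_zero_iff, mul_ne_zero_iff, mul_ne_zero_iff] at hF
  obtain ⟨⟨⟨hne, hdist⟩, hd1⟩, hd2⟩ := hF
  simp only [map_prod, Finset.prod_ne_zero_iff, Finset.mem_univ, forall_const] at hne hdist
  let ν (t : Fin 5) (j i : Fin 3) : GaloisField 2 m := φ (s t (μ j i))
  have eN : ∀ t, φ (s t (etaNum μ)) = etaNum (ν t) := fun t => by
    rw [map_etaNum, map_etaNum]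
  have eD : ∀ t, φ (s t (etaDen μ)) = etaDen (ν t) := fun t => by
    rw [map_etaDen, map_etaDen]
  simp only [D, map_det_pairingMatrix, eN, eD, map_mul] at hd1 hd2
  refine success_cadambeJafar hconn hrel (ν := ν) (fun _ _ _ => rfl) hne ?_ hd1 hd2
  intro t t' h
  by_contra hne'
  have h' := hdist t t'
  rw [if_neg hne', map_sub, map_mul, map_mul, eN, eD, eN, eD] at h'
  exact h' (sub_eq_zero.2
    ((div_eq_div_iff (etaDen_ne_zero (hne t)) (etaDen_ne_zero (hne t'))).1 h))

end PrecodingScheme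

/-! ### Type II networks -/

namespace SISOScenario

open PrecodingScheme

variable {V E : Type*} [Fintype E] {S : SISOScenario V E}

/-- After a cyclic renumbering of the sessions, the relation that makes a network Type II is the
cross relation `m₁₂ m₂₃ m₃₁ + m₁₃ m₂₁ m₃₂ = m₁₁ m₂₃ m₃₂`. -/
theorem TypeII.exists_relabel (hconn : S.FullyConnected) (hII : S.TypeII) :
    ∃ π : Equiv.Perm (Fin 3), CrossRelation ((S.relabel π).transfer (ZMod 2)) ∧
      (S.relabel π).transfer (ZMod 2) 0 2 * (S.relabel π).transfer (ZMod 2) 1 0 ≠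
        (S.relabel π).transfer (ZMod 2) 0 0 * (S.relabel π).transfer (ZMod 2) 1 2 ∧
      (S.relabel π).transfer (ZMod 2) 0 1 * (S.relabel π).transfer (ZMod 2) 2 0 ≠
        (S.relabel π).transfer (ZMod 2) 0 0 * (S.relabel π).transfer (ZMod 2) 2 1 := by
  have hinj := IsFractionRing.injective (MvPolynomial S.CodingVar (ZMod 2))
    (FractionRing (MvPolynomial S.CodingVar (ZMod 2)))
  have hne : ∀ j i, S.tf j i ≠ 0 := fun j i => (map_ne_zero_iff _ hinj).2
    (S.pathSum_ne_zero _ (reaches_of_fullyConnected hconn j i))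
  have hD := etaDen_ne_zero hne
  have hη : S.eta = etaNum S.tf / etaDen S.tf := rfl
  have h1η : 1 + S.eta = (etaDen S.tf + etaNum S.tf) / etaDen S.tf := by
    rw [hη, add_div, div_self hD]
  have key : ∀ π : Equiv.Perm (Fin 3), CrossRelation (fun j i => S.tf (π j) (π i)) →
      S.tf (π 0) (π 2) * S.tf (π 1) (π 0) ≠ S.tf (π 0) (π 0) * S.tf (π 1) (π 2) →
      S.tf (π 0) (π 1) * S.tf (π 2) (π 0) ≠ S.tf (π 0) (π 0) * S.tf (π 2) (π 1) →
      CrossRelation ((S.relabel π).transfer (ZMod 2)) ∧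
      (S.relabel π).transfer (ZMod 2) 0 2 * (S.relabel π).transfer (ZMod 2) 1 0 ≠
        (S.relabel π).transfer (ZMod 2) 0 0 * (S.relabel π).transfer (ZMod 2) 1 2 ∧
      (S.relabel π).transfer (ZMod 2) 0 1 * (S.relabel π).transfer (ZMod 2) 2 0 ≠
        (S.relabel π).transfer (ZMod 2) 0 0 * (S.relabel π).transfer (ZMod 2) 2 1 := by
    intro π h h1 h2
    let μ (j i : Fin 3) : MvPolynomial S.CodingVar (ZMod 2) := S.transfer (ZMod 2) (π j) (π i)
    have hμ : CrossRelation μ ∧ μ 0 2 * μ 1 0 ≠ μ 0 0 * μ 1 2 ∧ μ 0 1 * μ 2 0 ≠ μ 0 0 * μ 2 1 := by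
      refine ⟨hinj ?_, fun h' => h1 ?_, fun h' => h2 ?_⟩
      · simp only [map_add, map_mul]
        exact h
      · have := congrArg (algebraMap _ (FractionRing (MvPolynomial S.CodingVar (ZMod 2)))) h'
        simp only [map_mul] at this
        exact this
      · have := congrArg (algebraMap _ (FractionRing (MvPolynomial S.CodingVar (ZMod 2)))) h'
        simp only [map_mul] at this
        exact this
    exact hμ
  obtain ⟨hp, hrel⟩ := hII
  have hp1 : ∀ i, S.p i ≠ 1 := fun i => (hp i).1
  have hpη : ∀ i, S.p i ≠ etaNum S.tf / etaDen S.tf := fun i => (hp i).2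
  rcases hrel with h | h | h
  · refine ⟨1, key 1 ?_ (fun h' => hp1 0 ?_) (fun h' => hpη 0 ?_)⟩
    · change etaDen S.tf + etaNum S.tf = S.tf 0 0 * S.tf 1 2 * S.tf 2 1
      have hDN : etaDen S.tf + etaNum S.tf ≠ 0 := by
        intro h0
        -- If `1 + η = 0`, then `p₁`, which is nonzero, would equal `η / 0 = 0`.
        rw [h1η, h0, zero_div, div_zero] at h
        exact div_ne_zero (mul_ne_zero (hne 0 2) (hne 1 0)) (mul_ne_zero (hne 0 0) (hne 1 2)) h
      rw [h1η, hη, div_div_div_cancel_right₀ hD] at h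
      have h' := (div_eq_div_iff (mul_ne_zero (hne 0 0) (hne 1 2)) hDN).1 h
      refine mul_left_cancel₀ (mul_ne_zero (hne 0 2) (hne 1 0)) (h'.trans ?_)
      simp only [etaNum]
      ring
    · exact (div_eq_one_iff_eq (mul_ne_zero (hne 0 0) (hne 1 2))).2 h'
    · refine (div_eq_div_iff (mul_ne_zero (hne 0 0) (hne 1 2)) hD).2 ?_
      simp only [etaNum, etaDen]
      change S.tf 0 1 * S.tf 2 0 = S.tf 0 0 * S.tf 2 1 at h'
      linear_combination S.tf 0 2 * S.tf 1 0 * S.tf 1 2 * h'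
  · refine ⟨Equiv.addRight 1, key _ ?_ (fun h' => hpη 1 ?_) (fun h' => hp1 1 ?_)⟩
    · change S.tf 1 2 * S.tf 2 0 * S.tf 0 1 + S.tf 1 0 * S.tf 2 1 * S.tf 0 2 =
        S.tf 1 1 * S.tf 2 0 * S.tf 0 2
      rw [h1η] at h
      have h' := (div_eq_div_iff (mul_ne_zero (hne 0 1) (hne 1 2)) hD).1 h
      refine mul_left_cancel₀ (mul_ne_zero (hne 0 1) (hne 1 2)) ?_
      simp only [etaNum, etaDen] at h'
      linear_combination -h'
    · refine (div_eq_div_iff (mul_ne_zero (hne 0 1) (hne 1 2)) hD).2 ?_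
      simp only [etaNum, etaDen]
      change S.tf 1 0 * S.tf 2 1 = S.tf 1 1 * S.tf 2 0 at h'
      linear_combination -(S.tf 0 2 * S.tf 0 1 * S.tf 1 2) * h'
    · refine (div_eq_one_iff_eq (mul_ne_zero (hne 0 1) (hne 1 2))).2 ?_
      change S.tf 1 2 * S.tf 0 1 = S.tf 1 1 * S.tf 0 2 at h'
      linear_combination -h'
  · refine ⟨Equiv.addRight 2, key _ ?_ (fun h' => hpη 2 ?_) (fun h' => hp1 2 ?_)⟩
    · change S.tf 2 0 * S.tf 0 1 * S.tf 1 2 + S.tf 2 1 * S.tf 0 2 * S.tf 1 0 =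
        S.tf 2 2 * S.tf 0 1 * S.tf 1 0
      rw [h1η] at h
      have h' := (div_eq_div_iff (mul_ne_zero (hne 1 2) (hne 2 0)) hD).1 h
      refine mul_left_cancel₀ (mul_ne_zero (hne 1 2) (hne 2 0)) ?_
      simp only [etaNum, etaDen] at h'
      linear_combination -h'
    · refine (div_eq_div_iff (mul_ne_zero (hne 1 2) (hne 2 0)) hD).2 ?_
      simp only [etaNum, etaDen]
      change S.tf 2 1 * S.tf 0 2 = S.tf 2 2 * S.tf 0 1 at h'
      linear_combination -(S.tf 1 0 * S.tf 1 2 * S.tf 2 0) * h'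
    · refine (div_eq_one_iff_eq (mul_ne_zero (hne 1 2) (hne 2 0))).2 ?_
      change S.tf 2 0 * S.tf 1 2 = S.tf 2 2 * S.tf 1 0 at h'
      linear_combination -h'

end SISOScenario

open SISOScenario PrecodingScheme in
theorem mainTheorem8 {V E : Type*} [Fintype E] (S : SISOScenario V E)
    (hconn : S.FullyConnected) (hII : S.TypeII) :
    (∃ π : Equiv.Perm (Fin 3),
      PrecodingScheme.IsPBNA (S.relabel π)
        (PrecodingScheme.cadambeJafar (S.relabel π) 2) 2 1 ∧
      ∃ c : (i : Fin 3) → Fin 2 ↪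
          Fin ((PrecodingScheme.cadambeJafar (S.relabel π) 2).k i),
        PrecodingScheme.Achieves (S.relabel π)
          ((PrecodingScheme.cadambeJafar (S.relabel π) 2).select (fun _ => 2) c)
          (fun _ => 2 / 5)) ∧
    IsGreatest
      {R : ℚ | ∃ lam : PrecodingScheme S.toNetwork,
        PrecodingScheme.Achieves S lam (fun _ => R)} (2 / 5) := by
  obtain ⟨π, hrel, h1, h2⟩ := hII.exists_relabel hconn
  have hconn' : (S.relabel π).FullyConnected := fun i j => hconn _ _
  have hach := achieves_cadambeJafar hconn' hrel h1 h2
  refine ⟨⟨π, isPBNA_cadambeJafar hconn' hrel two_pos, _, hach⟩, ?_⟩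
  change IsGreatest (SymmetricRates S) (2 / 5)
  rw [← symmetricRates_relabel S π]
  exact ⟨⟨_, hach⟩, fun R hR => le_of_mem_symmetricRates _ hconn' hrel hR⟩
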